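/- **Setting.** Let $\mathbb F_q\subset\mathbb F_{q^m}\subset\mathbb F_{q^{m\eta}}$ be finite fields, $k\le n$, $r\ge 1$, $N=2^D$. An instance of Rank-SD is $(\boldsymbol H,\boldsymbol y)$ with $\boldsymbol H=(\boldsymbol I\,\|\,\boldsymbol H')\in\mathbb F_{q^m}^{(n-k)\times n}$ and $\boldsymbol y\in\mathbb F_{q^m}^{n-k}$; a *witness* is $\boldsymbol x\in\mathbb F_{q^m}^n$ with $\boldsymbol H\boldsymbol x=\boldsymbol y$ and $W_R(\boldsymbol x)\le r$, where $W_R(\boldsymbol x)$ is the rank over $\mathbb F_q$ of the matrix of coordinates of $x_1,\dots,x_n$ in an $\mathbb F_q$-basis of $\mathbb F_{q^m}$. **Protocol.** A commitment scheme $\mathsf{Com}$, a hash function $\mathsf H$, a pseudo-random generator and a seed tree (GGM tree) with $N$ leaves are fixed (arbitrary functions). The leaves are indexed by $i\in\{1,2\}^D$; the last one, $(2,\dots,2)$, is leaf $N$. Leaf $i\neq N$ has state $\mathsf{state}_i=\mathsf{seed}_i$, from which its shares $[\boldsymbol x_B]_i\in\mathbb F_{q^m}^k$, $[\boldsymbol\beta]_i\in\mathbb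 F_{q^m}^{r-1}$, $[\boldsymbol a]_i\in\mathbb F_{q^{m\eta}}^{r-1}$, $[c]_i\in\mathbb F_{q^{m\eta}}$ are generated; leaf $N$ has state $(\mathsf{seed}_N,[\boldsymbol x_B]_N,[\boldsymbol\beta]_N,[c]_N)$, and $[\boldsymbol a]_N$ is generated from $\mathsf{seed}_N$. The main party $(d,b)$, for $1\le d\le D$ and $b\in\{1,2\}$, holds the sums of the shares of the leaves $i$ with $i_d=b$. 1. The prover sends $h_0$ (meant to be $\mathsf H(\mathsf{cmt}_1,\dots,\mathsf{cmt}_N)$ with $\mathsf{cmt}_i=\mathsf{Com}(\mathsf{state}_i,\rho_i)$). 2. The verifier sends uniform $(\gamma_1,\dots,\gamma_n,\varepsilon)\in\mathbb F_{q^{m\eta}}^{n+1}$. 3. The prover sends $h_1$ (meant to be $\mathsf H(H_1,\dots,H_D)$ with $H_d=\mathsf H([\boldsymbol\alpha]_{(d,\cdot)},[v]_{(d,\cdot)})$). 4. The verifier sends a uniform leaf $i^*$. 5. The prover sends the salt and the sibling path of $i^*$ in the seed tree, which determine $(\mathsf{seed}_j,\rho_j)$ for $j\neq i^*$; $[\boldsymbol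 x_B]_N,[\boldsymbol\beta]_N,[c]_N$ if $i^*\ne N$; $\mathsf{cmt}_{i^*}$; and the share $[\boldsymbol\alpha]_{i^*}$. A party with shares $[\cdot]$ computes $[\boldsymbol x]=([\boldsymbol y]-\boldsymbol H'[\boldsymbol x_B]\,\|\,[\boldsymbol x_B])$, where $[\boldsymbol y]=\boldsymbol y$ for leaf $N$ and for the main parties containing it and $[\boldsymbol y]=0$ otherwise; then, for $1\le e\le r-1$, $[\alpha_e]=\varepsilon\sum_j\gamma_j([x_j]^{q^e}-[x_j])+[a_e]$; and, with $\boldsymbol\alpha$ the sum of the two shares of $\boldsymbol\alpha$ in dimension $d$, $[v]=-\varepsilon\sum_j\gamma_j([x_j]^{q^r}-[x_j])-\langle\boldsymbol\alpha,[\boldsymbol\beta]\rangle-[c]$. The verifier does this for the main parties not containing $i^*$; for the one containing $i^*$ in dimension $d$, the share of $\boldsymbol\alpha$ is the sum of the received $[\boldsymbol\alpha]_{i^*}$ and of those of its other leaves, and the share of $v$ is set so that the two shares of $v$ sum to $0$. The verifier accepts if the recomputed commitments hash to $h_0$, $v=0$ in all dimensions, $\boldsymbol\alpha$ is the same in all dimensions,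 and the recomputed hashes give $h_1$. **Provers and extractors.** A prover $\tilde{\mathcal P}$ is given by a distribution of random tapes and, for each tape, its messages as functions of the challenges received. An extractor with rewindable access makes calls to $\tilde{\mathcal P}$; a call is an execution of the protocol with challenges of the extractor's choice, on a fresh random tape or on that of an earlier call. It chooses its calls at random, depending on its earlier calls and on whether they were accepted. It halts as soon as two of the transcripts obtained yield a *commitment collision* (two openings of a leaf commitment to distinct states, or two distinct inputs of $\mathsf H$ with the same hash, occurring in the verification of these two transcripts) or a witness, namely $(\boldsymbol y-\boldsymbol H'\boldsymbol x_B\,\|\,\boldsymbol x_B)$ with $\boldsymbol x_B$ the sum of the shares of all $N$ leaves read from two transcripts with distinct hidden leaves, and outputs it. **Theorem.** Let $p=\frac{2}{q^{m\eta}}-\frac1{q^{2m\eta}}$, $\epsilon=p+(1-p)\frac1N$ and $\tilde\epsilon>\epsilon$. There is an extractor $\mathcal E$ such that for all choices of the primitives, every instance $(\boldsymbol H,\boldsymbol y)$ and every prover $\tilde{\mathcal P}$ that makes the verifier accept with probability $\tilde\epsilon$, $\mathcal E$ halts with probability $1$ and outputs a commitment collision or a witness of the instance, and its expected number of calls to $\tilde{\mathcal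 P}$ is at most $$\frac{4}{\tilde\epsilon-\epsilon}\left(1+\frac{2\tilde\epsilon\ln 2}{\tilde\epsilon-\epsilon}\right).$$ -/

import Mathlib

open scoped ENNReal Topology

noncomputable section

namespace RankSD

/-! ### Rank metric and the rank syndrome decoding relation -/

/-- Coordinates of a vector `x = (x_A ‖ x_B)` of length `n`, with `x_A` of length `n - k` and
`x_B` of length `k`. -/
abbrev Coord (n k : ℕ) := Fin (n - k) ⊕ Fin k

/-- Rank weight over `F` of a vector with entries in the extension `K`: the rank of the matrix of
the coordinates of its entries in a basis of `K` over `F`. -/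
def rankWeight (F : Type*) {K ι : Type*} [Field F] [Field K] [Algebra F K] [Module.Finite F K]
    (x : ι → K) : ℕ :=
  Matrix.rank (Matrix.of fun i j => (Module.finBasis F K).repr (x i) j)

/-- Public data: the non-identity block of a parity check matrix in standard form, and a
syndrome. -/
structure Instance (K : Type*) (n k : ℕ) where
  H' : Matrix (Fin (n - k)) (Fin k) K
  y : Fin (n - k) → K

/-- The parity check matrix `H = (I ‖ H')`. -/
def Instance.H {K : Type*} [Field K] {n k : ℕ} (I : Instance K n k) :
    Matrix (Fin (n - k)) (Coord n k) K :=
  Matrix.fromCols 1 I.H'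

/-- `x` is a good witness: `H x = y` and `x` has rank weight at most `r`. -/
def Instance.IsWitness (F : Type*) {K : Type*} [Field F] [Field K] [Algebra F K]
    [Module.Finite F K] {n k : ℕ} (I : Instance K n k) (r : ℕ) (x : Coord n k → K) : Prop :=
  I.H.mulVec x = I.y ∧ rankWeight F x ≤ r

/-! ### Shares and the multi-party computation -/

/-- An additive share of `(x_B, β, a, c)`. The entries of `β` and `a` are those of
index `1, …, r - 1`. Here `K` has `q ^ m` elements and `L` has `q ^ (m η)`. -/
@[ext] structure Share (K L : Type*) (k r : ℕ) where
  xB : Fin k → K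
  β : Fin (r - 1) → K
  a : Fin (r - 1) → L
  c : L

/-- Sum of a family of shares. -/
def Share.sum {K L ι : Type*} [Field K] [Field L] {k r : ℕ} (s : Finset ι)
    (f : ι → Share K L k r) : Share K L k r where
  xB := ∑ i ∈ s, (f i).xB
  β := ∑ i ∈ s, (f i).β
  a := ∑ i ∈ s, (f i).a
  c := ∑ i ∈ s, (f i).c

/-- First challenge: `((γ_j)_j, ε)`. -/
abbrev Ch1 (L : Type*) (n k : ℕ) := (Coord n k → L) × L

/-- The `N = 2 ^ D` leaf parties, indexed by their coordinates on the hypercube. -/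
abbrev Leaf (D : ℕ) := Fin D → Bool

/-- The leaf party of number `N`, whose coordinates are all maximal. -/
def lastLeaf (D : ℕ) : Leaf D := fun _ => true

section MPC

variable {K L : Type*} [Field K] [Field L] [Algebra K L] {n k r : ℕ}

/-- The vector `x = (y - H' x_B ‖ x_B)`. For additive shares only one party adds the constant
`y`: `const` tells whether the party at hand is that one. -/
def fullVec (I : Instance K n k) (const : Prop) [Decidable const] (xB : Fin k → K) :
    Coord n k → K :=
  Sum.elim ((if const then I.y else 0) - I.H'.mulVec xB) xB

/-- `∑_j γ_j (x_j ^ (q ^ e) - x_j)`. -/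
def frobSum (q : ℕ) (γ : Coord n k → L) (x : Coord n k → K) (e : ℕ) : L :=
  ∑ j, γ j * algebraMap K L (x j ^ q ^ e - x j)

/-- The share of `α = ε ω + a` computed by a party, where `ω_e = ∑_j γ_j (x_j ^ (q ^ e) - x_j)`
for `e = 1, …, r - 1`. -/
def alphaShare (q : ℕ) (I : Instance K n k) (ch : Ch1 L n k) (const : Prop) [Decidable const]
    (s : Share K L k r) : Fin (r - 1) → L :=
  fun e => ch.2 * frobSum q ch.1 (fullVec I const s.xB) (e.val + 1) + s.a e

/-- The share of `v = ε z - ⟨α, β⟩ - c` computed by a party from the opened value `α`, where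
`z = -∑_j γ_j (x_j ^ (q ^ r) - x_j)`. -/
def vShare (q : ℕ) (I : Instance K n k) (ch : Ch1 L n k) (const : Prop) [Decidable const]
    (α : Fin (r - 1) → L) (s : Share K L k r) : L :=
  ch.2 * (-frobSum q ch.1 (fullVec I const s.xB) r)
    - (∑ e, α e * algebraMap K L (s.β e)) - s.c

end MPC

/-! ### Symmetric primitives -/

/-- Committed state of a leaf: its seed, together with the shares of `x_B`, `β`, `c` for the
last leaf. -/
inductive LeafState (K L : Type*) (k r : ℕ) (Seed : Type*)
  | plain (seed : Seed)
  | last (seed : Seed) (xB : Fin k → K) (β : Fin (r - 1) → K) (c : L)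

/-- The symmetric primitives of the protocol. They are arbitrary functions. The hash function is
used on three kinds of input, and is represented by its restrictions to them. -/
structure Primitives (K L : Type*) (k r D : ℕ) (Seed Salt Rnd Cmt Dig : Type*) where
  /-- one expansion step of the seed tree -/
  ggm : Salt → Seed → Seed × Seed
  /-- seed and commitment randomness of a leaf, from the leaf node of the seed tree -/
  leafOut : Salt → Seed → Seed × Rnd
  /-- pseudo-random generation of a share -/
  prg : Seed → Share K L k r
  /-- commitment scheme -/
  com : LeafState K L k r Seed → Rnd → Cmt
  /-- hash of the `N` leaf commitments, giving `h₀` -/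
  hashCmts : (Leaf D → Cmt) → Dig
  /-- hash of the shares of `α` and `v` of the two main parties of a dimension, giving `H_d` -/
  hashExec : (Bool → Fin (r - 1) → L) × (Bool → L) → Dig
  /-- hash of `(H_1, …, H_D)`, giving `h₁` -/
  hashAll : (Fin D → Dig) → Dig

/-- Second response of the prover for the hidden leaf `i*`: the salt and the sibling path of `i*`
in the seed tree (`path l` is the seed of the node that leaves the path to `i*` at level `l`), the
shares of `x_B`, `β`, `c` of the last leaf (ignored if the last leaf is the hidden one), the
commitment of the hidden leaf and its share of `α`. -/
structure Response (K L : Type*) (k r D : ℕ) (Seed Salt Cmt : Type*) where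
  salt : Salt
  path : Fin D → Seed
  auxXB : Fin k → K
  auxβ : Fin (r - 1) → K
  auxC : L
  cmt : Cmt
  α : Fin (r - 1) → L

/-- A transcript `(h₀, ch₁, h₁, ch₂, rsp)`. -/
structure Transcript (K L : Type*) (n k r D : ℕ) (Seed Salt Cmt Dig : Type*) where
  h0 : Dig
  ch1 : Ch1 L n k
  h1 : Dig
  ch2 : Leaf D
  rsp : Response K L k r D Seed Salt Cmt

/-- First coordinate at which two distinct leaves differ. -/
def firstDiff {D : ℕ} (i j : Leaf D) (h : j ≠ i) : Fin D :=
  (Finset.univ.filter fun l => j l ≠ i l).min' (by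
    obtain ⟨l, hl⟩ := Function.ne_iff.mp h
    exact ⟨l, by simpa using hl⟩)

section Verification

variable {K L : Type*} [Field K] [Field L] [Algebra K L] {n k r D : ℕ}
  {Seed Salt Rnd Cmt Dig : Type*}
  (S : Primitives K L k r D Seed Salt Rnd Cmt Dig) (I : Instance K n k) (q : ℕ)
  (T : Transcript K L n k r D Seed Salt Cmt Dig)

/-- Shares encoded by the state of a leaf. -/
def Primitives.shareOf : LeafState K L k r Seed → Share K L k r
  | .plain s => S.prg s
  | .last s xB β c => { xB := xB, β := β, a := (S.prg s).a, c := c }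

namespace Transcript

/-- The node of the seed tree at an opened leaf `j`, recomputed from the sibling path. -/
def leafNode (j : {j : Leaf D // j ≠ T.ch2}) : Seed :=
  ((List.ofFn j.1).drop ((firstDiff T.ch2 j.1 j.2).val + 1)).foldl
    (fun s b => if b then (S.ggm T.rsp.salt s).2 else (S.ggm T.rsp.salt s).1)
    (T.rsp.path (firstDiff T.ch2 j.1 j.2))

/-- State of an opened leaf. -/
def state (j : {j : Leaf D // j ≠ T.ch2}) : LeafState K L k r Seed :=
  let s := (S.leafOut T.rsp.salt (T.leafNode S j)).1
  if j.1 = lastLeaf D then .last s T.rsp.auxXB T.rsp.auxβ T.rsp.auxC else .plain s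

/-- Commitment randomness of an opened leaf. -/
def rnd (j : {j : Leaf D // j ≠ T.ch2}) : Rnd :=
  (S.leafOut T.rsp.salt (T.leafNode S j)).2

/-- Shares of an opened leaf. -/
def share (j : {j : Leaf D // j ≠ T.ch2}) : Share K L k r := S.shareOf (T.state S j)

/-- The `N` leaf commitments: recomputed for the opened leaves, received for the hidden one. -/
def cmts (j : Leaf D) : Cmt :=
  if h : j ≠ T.ch2 then S.com (T.state S ⟨j, h⟩) (T.rnd S ⟨j, h⟩) else T.rsp.cmt

/-- Shares of the main party `(d, b)`, summed over its opened leaves. These are all its leaves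
unless it contains the hidden leaf. -/
def mainShare (d : Fin D) (b : Bool) : Share K L k r :=
  Share.sum (Finset.univ.filter fun j : {j : Leaf D // j ≠ T.ch2} => j.1 d = b) (T.share S)

/-- Share of `α` of the main party `(d, b)`. It is the one computed from its input shares if all
its leaves are opened; otherwise it is the sum of the share of `α` received for the hidden leaf and
of those of its other leaves. The constant `y` is added by the last leaf, hence by the main parties
that contain it. -/
def mainAlpha (d : Fin D) (b : Bool) : Fin (r - 1) → L :=
  if T.ch2 d = b then
    T.rsp.α + ∑ j : {j : Leaf D // j ≠ T.ch2},
      if j.1 d = b then alphaShare q I T.ch1 (j.1 = lastLeaf D) (T.share S j) else 0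
  else alphaShare q I T.ch1 (b = true) (T.mainShare S d b)

/-- The value `α` opened in the execution of dimension `d`. -/
def alpha (d : Fin D) : Fin (r - 1) → L := ∑ b, T.mainAlpha S I q d b

/-- Share of `v` of the main party `(d, b)`. It is computed from its input shares if all its leaves
are opened; otherwise it is set so that the two shares of `v` sum to `0`. -/
def mainV (d : Fin D) (b : Bool) : L :=
  if T.ch2 d = b then -vShare q I T.ch1 ((!b) = true) (T.alpha S I q d) (T.mainShare S d (!b))
  else vShare q I T.ch1 (b = true) (T.alpha S I q d) (T.mainShare S d b)

/-- The hashed data of the execution of dimension `d`. -/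
def exec (d : Fin D) : (Bool → Fin (r - 1) → L) × (Bool → L) :=
  (T.mainAlpha S I q d, T.mainV S I q d)

/-- The hashes `(H_1, …, H_D)` recomputed by the verifier. -/
def execHashes (d : Fin D) : Dig := S.hashExec (T.exec S I q d)

/-- The decision of the verifier. -/
def Accepts : Prop :=
  S.hashCmts (T.cmts S) = T.h0 ∧
  (∀ d, ∑ b, T.mainV S I q d b = 0) ∧
  (∀ d d', T.alpha S I q d = T.alpha S I q d') ∧
  S.hashAll (T.execHashes S I q) = T.h1

end Transcript

end Verification

/-! ### Malicious provers -/

/-- A malicious prover: a distribution of random tapes and, for each tape, the three messages as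
functions of the challenges received so far. -/
structure Prover (K L : Type*) (n k r D : ℕ) (Seed Salt Cmt Dig Tape : Type*) where
  tape : PMF Tape
  commit : Tape → Dig
  respond1 : Tape → Ch1 L n k → Dig
  respond2 : Tape → Ch1 L n k → Leaf D → Response K L k r D Seed Salt Cmt

/-- The transcript of an execution with given tape and challenges. -/
def Prover.transcript {K L : Type*} {n k r D : ℕ} {Seed Salt Cmt Dig Tape : Type*}
    (P : Prover K L n k r D Seed Salt Cmt Dig Tape) (t : Tape) (ch1 : Ch1 L n k) (i : Leaf D) :
    Transcript K L n k r D Seed Salt Cmt Dig where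
  h0 := P.commit t
  ch1 := ch1
  h1 := P.respond1 t ch1
  ch2 := i
  rsp := P.respond2 t ch1 i

/-- Probability that the honest verifier, who samples both challenges uniformly, accepts. -/
def Prover.acceptProb {K L : Type*} [Field K] [Field L] [Algebra K L] [Fintype L]
    {n k r D : ℕ} {Seed Salt Rnd Cmt Dig Tape : Type*}
    (P : Prover K L n k r D Seed Salt Cmt Dig Tape)
    (S : Primitives K L k r D Seed Salt Rnd Cmt Dig) (I : Instance K n k) (q : ℕ) : ℝ :=
  ((P.tape.bind fun t =>
    (PMF.uniformOfFintype (Ch1 L n k)).bind fun ch1 =>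
      (PMF.uniformOfFintype (Leaf D)).map fun i =>
        P.transcript t ch1 i).toOuterMeasure {T | T.Accepts S I q}).toReal

/-! ### Outputs of the extractor -/

/-- Possible outputs: two openings of a leaf commitment, two inputs of the hash function, or a
vector. -/
inductive Output (K L : Type*) (n k r D : ℕ) (Seed Rnd Cmt Dig : Type*)
  | com (s s' : LeafState K L k r Seed) (ρ ρ' : Rnd)
  | hashCmts (u u' : Leaf D → Cmt)
  | hashExec (u u' : (Bool → Fin (r - 1) → L) × (Bool → L))
  | hashAll (u u' : Fin D → Dig)
  | witness (x : Coord n k → K)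

section Outputs

variable {K L : Type*} [Field K] [Field L] [Algebra K L] {n k r D : ℕ}
  {Seed Salt Rnd Cmt Dig : Type*}

/-- The output is a collision of the commitment scheme or of the hash function, or a good
witness. -/
def Output.Valid (F : Type*) [Field F] [Algebra F K] [Module.Finite F K]
    (S : Primitives K L k r D Seed Salt Rnd Cmt Dig) (I : Instance K n k) :
    Output K L n k r D Seed Rnd Cmt Dig → Prop
  | .com s s' ρ ρ' => s ≠ s' ∧ S.com s ρ = S.com s' ρ'
  | .hashCmts u u' => u ≠ u' ∧ S.hashCmts u = S.hashCmts u'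
  | .hashExec u u' => u ≠ u' ∧ S.hashExec u = S.hashExec u'
  | .hashAll u u' => u ≠ u' ∧ S.hashAll u = S.hashAll u'
  | .witness x => I.IsWitness F r x

open Classical in
/-- The candidate outputs that are read off from two transcripts `T`, `T'`: the openings of each
leaf opened in both, the three kinds of hash inputs and, if the hidden leaves differ, the vector
`(y - H' x_B ‖ x_B)`, where `x_B` is the sum of the shares of all leaves (that of the leaf hidden
in `T` is taken from `T'`). -/
def readOff (S : Primitives K L k r D Seed Salt Rnd Cmt Dig) (I : Instance K n k) (q : ℕ)
    (T T' : Transcript K L n k r D Seed Salt Cmt Dig) :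
    List (Output K L n k r D Seed Rnd Cmt Dig) :=
  ((Finset.univ : Finset {j : Leaf D // j ≠ T.ch2 ∧ j ≠ T'.ch2}).toList.map fun j =>
    .com (T.state S ⟨j.1, j.2.1⟩) (T'.state S ⟨j.1, j.2.2⟩)
      (T.rnd S ⟨j.1, j.2.1⟩) (T'.rnd S ⟨j.1, j.2.2⟩))
  ++ [.hashCmts (T.cmts S) (T'.cmts S)]
  ++ ((Finset.univ : Finset (Fin D)).toList.map fun d =>
    .hashExec (T.exec S I q d) (T'.exec S I q d))
  ++ [.hashAll (T.execHashes S I q) (T'.execHashes S I q)]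
  ++ (if h : T.ch2 ≠ T'.ch2 then
      [.witness (fullVec I True ((∑ j, (T.share S j).xB) + (T'.share S ⟨T.ch2, h⟩).xB))]
    else [])

end Outputs

/-! ### Extractors with rewindable access to the prover -/

/-- A call to the prover: one execution of the protocol with chosen challenges. Calls with the same
session label run the prover on the same random tape (rewinding); the first call of each session
draws a fresh tape. -/
structure Query (L : Type*) (n k D : ℕ) where
  session : ℕ
  ch1 : Ch1 L n k
  ch2 : Leaf D

/-- An extractor is given by its randomized choice of the next call, depending on its earlier calls
(latest first) and on whether each of them was accepted. It has no access to the random tapes. -/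
structure Extractor (L : Type*) (n k D : ℕ) where
  next : List (Query L n k D × Bool) → PMF (Query L n k D)

namespace Extractor

variable {K L : Type*} [Field K] [Field L] [Algebra K L] {n k r D : ℕ}
  {Seed Salt Rnd Cmt Dig Tape : Type*}
  (E : Extractor L n k D)
  (F : Type*) [Field F] [Fintype F] [Algebra F K] [Module.Finite F K]
  (S : Primitives K L k r D Seed Salt Rnd Cmt Dig) (I : Instance K n k)
  (P : Prover K L n k r D Seed Salt Cmt Dig Tape)

/-- The transcripts of a list of calls. -/
def transcripts (h : List (Query L n k D × Tape)) :
    List (Transcript K L n k r D Seed Salt Cmt Dig) :=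
  h.map fun c => P.transcript c.2 c.1.ch1 c.1.ch2

open Classical in
/-- After each call, the extractor tests all the candidates that can be read off from two of the
transcripts obtained so far; it halts with the first valid one as output. -/
def output (h : List (Query L n k D × Tape)) : Option (Output K L n k r D Seed Rnd Cmt Dig) :=
  ((transcripts P h).flatMap fun T => (transcripts P h).flatMap fun T' =>
    readOff S I (Fintype.card F) T T').find? fun o => decide (o.Valid F S I)

open Classical in
/-- One step of the interaction: nothing happens once the extractor has halted, otherwise it makes
one more call. -/
def step (h : List (Query L n k D × Tape)) : PMF (List (Query L n k D × Tape)) :=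
  if (output F S I P h).isSome then PMF.pure h
  else
    (E.next (h.map fun c : Query L n k D × Tape =>
        (c.1, decide ((P.transcript c.2 c.1.ch1 c.1.ch2).Accepts S I (Fintype.card F))))).bind
      fun qry =>
        (match h.find? (fun c : Query L n k D × Tape => decide (c.1.session = qry.session)) with
          | some c => PMF.pure c.2
          | none => P.tape).map fun t => (qry, t) :: h

/-- Distribution of the list of calls made by the extractor after `t` steps. -/
def run : ℕ → PMF (List (Query L n k D × Tape))
  | 0 => PMF.pure []
  | t + 1 => (run t).bind (E.step F S I P)

/-- Probability that within `t` calls the extractor has halted with a valid output. -/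
def successProb (t : ℕ) : ℝ≥0∞ :=
  (E.run F S I P t).toOuterMeasure {h | ∃ o, output F S I P h = some o ∧ o.Valid F S I}

/-- Expected total number of calls to the prover (the limit of the expected number of calls made
in the first `t` steps). -/
def expectedCalls : ℝ≥0∞ :=
  ⨆ t, ∑' h, E.run F S I P t h * (h.length : ℝ≥0∞)

end Extractor

/-- The false positive rate `p = 2 / q ^ (m η) - 1 / q ^ (2 m η)`. -/
def falsePositiveRate (q m η : ℕ) : ℝ := 2 / (q : ℝ) ^ (m * η) - 1 / (q : ℝ) ^ (2 * m * η)

/-- The soundness error `ε = p + (1 - p) / N`, with `N = 2 ^ D`. -/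
def soundnessError (q m η D : ℕ) : ℝ :=
  falsePositiveRate q m η + (1 - falsePositiveRate q m η) * (1 / (2 : ℝ) ^ D)

end RankSD

end

/-!
The extractor draws fresh tapes and uniform challenges. After an accepted call it repeats the first
challenge at most `B ≈ 1 / Δ` times with new hidden leaves, looking for a *pair*: two accepted calls
with the same tape and first challenge and distinct hidden leaves. Having found a pair, it looks for
another one on the same tape; if that one yields no output either, it goes back to the start.

Unless a collision is found, a first pair fixes the shares of all leaves, hence the vector `x` and
the value `v` that the honest parties compute on every first challenge. If `x` is not a witness,
its coordinates are not roots of a common `q`-polynomial of `q`-degree `r`, so `v` vanishes on a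
fraction at most `p` of the first challenges. Let `G` be their set: a further pair on this tape
outside `G` gives a collision.

Consider a fixed tape with acceptance probability `ρ`. Let `π` be the probability that an attempt
yields a pair, `A ≤ 1 + ρ B` its expected cost and `E` a lower bound for the probability of a pair
outside `G`. If `V` is the expected cost from the start, then `U = (A + (π - E) V) / π` suffices
after a first pair, and the attempt at the start costs `A + π U + (1 - π) V = V + 2 A - E V`.
Replacing `W ↦ B W² / (1 + B W)` by its tangent line at `Δ` makes `E` affine in `ρ`, so averaging
over the tapes only involves the acceptance probability of the prover. This shows that `V` bounds
the expected number of calls, and `B = ⌈1 / Δ⌉` gives the stated constant.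
-/

open scoped BigOperators

noncomputable section

namespace RankSD

/-! ### Expectations under a probability mass function -/

section Expectation

variable {α β : Type*}

/-- Expectation of an extended nonnegative function under a probability mass function. As a plain
sum, it needs no measurable structure on the sample space. -/
def expectation (p : PMF α) (g : α → ℝ≥0∞) : ℝ≥0∞ := ∑' x, p x * g x

theorem expectation_mono (p : PMF α) {f g : α → ℝ≥0∞} (h : ∀ x, f x ≤ g x) :
    expectation p f ≤ expectation p g :=
  ENNReal.tsum_le_tsum fun x => mul_le_mul_right (h x) _

theorem expectation_const (p : PMF α) (a : ℝ≥0∞) : expectation p (fun _ => a) = a := by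
  rw [expectation, ENNReal.tsum_mul_right, p.tsum_coe, one_mul]

theorem expectation_add (p : PMF α) (f g : α → ℝ≥0∞) :
    expectation p (fun x => f x + g x) = expectation p f + expectation p g := by
  simp only [expectation, mul_add, ENNReal.tsum_add]

theorem expectation_const_mul (p : PMF α) (a : ℝ≥0∞) (g : α → ℝ≥0∞) :
    expectation p (fun x => a * g x) = a * expectation p g := by
  simp only [expectation, ← ENNReal.tsum_mul_left, mul_left_comm a]

theorem expectation_pure (a : α) (g : α → ℝ≥0∞) : expectation (PMF.pure a) g = g a := by
  rw [expectation, tsum_eq_single a fun b hb => by simp [hb]]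
  simp

theorem expectation_bind (p : PMF α) (f : α → PMF β) (g : β → ℝ≥0∞) :
    expectation (p.bind f) g = expectation p fun a => expectation (f a) g := by
  simp only [expectation, PMF.bind_apply, ← ENNReal.tsum_mul_right, ← ENNReal.tsum_mul_left,
    mul_assoc]
  exact ENNReal.tsum_comm

theorem expectation_map (p : PMF α) (f : α → β) (g : β → ℝ≥0∞) :
    expectation (p.map f) g = expectation p fun a => g (f a) := by
  simp only [PMF.map, expectation_bind, Function.comp_apply, expectation_pure]

theorem expectation_comm (p : PMF α) (p' : PMF β) (g : α → β → ℝ≥0∞) :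
    expectation p (fun a => expectation p' (g a))
      = expectation p' fun b => expectation p fun a => g a b := by
  simp only [expectation, ← ENNReal.tsum_mul_left, mul_left_comm (p _)]
  exact ENNReal.tsum_comm

theorem expectation_uniformOfFintype_ofReal [Fintype α] [Nonempty α] {g : α → ℝ}
    (hg : ∀ x, 0 ≤ g x) :
    expectation (PMF.uniformOfFintype α) (fun x => ENNReal.ofReal (g x))
      = ENNReal.ofReal (𝔼 x, g x) := by
  rw [expectation, tsum_fintype, Fintype.expect_eq_sum_div_card,
    ENNReal.ofReal_div_of_pos (by positivity), ENNReal.ofReal_sum_of_nonneg fun x _ => hg x,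
    ENNReal.ofReal_natCast, ENNReal.div_eq_inv_mul, Finset.mul_sum]
  simp only [PMF.uniformOfFintype_apply]

theorem toOuterMeasure_eq_expectation (p : PMF α) (s : Set α) [DecidablePred (· ∈ s)] :
    p.toOuterMeasure s = expectation p fun x => if x ∈ s then 1 else 0 := by
  simp [PMF.toOuterMeasure_apply, expectation, Set.indicator_apply]

theorem expectation_ofReal_le_of_affine (p : PMF α) {f ρ : α → ℝ} {a b c m : ℝ}
    (hf : ∀ x, 0 ≤ f x) (hρ : ∀ x, 0 ≤ ρ x) (ha : 0 ≤ a) (hb : 0 ≤ b) (hc : 0 ≤ c) (hm : 0 ≤ m)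
    (hp : expectation p (fun x => ENNReal.ofReal (ρ x)) = ENNReal.ofReal m)
    (hle : ∀ x, f x + a * ρ x ≤ b + c * ρ x) :
    expectation p (fun x => ENNReal.ofReal (f x)) ≤ ENNReal.ofReal (b + c * m - a * m) := by
  have key : expectation p (fun x => ENNReal.ofReal (f x)) + ENNReal.ofReal (a * m)
      ≤ ENNReal.ofReal (b + c * m) := by
    rw [ENNReal.ofReal_add hb (by positivity), ENNReal.ofReal_mul ha, ENNReal.ofReal_mul hc, ← hp,
      ← expectation_const_mul, ← expectation_const_mul, ← expectation_const p (ENNReal.ofReal b),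
      ← expectation_add, ← expectation_add]
    refine expectation_mono p fun x => ?_
    rw [← ENNReal.ofReal_mul ha, ← ENNReal.ofReal_mul hc,
      ← ENNReal.ofReal_add (hf x) (mul_nonneg ha (hρ x)),
      ← ENNReal.ofReal_add hb (mul_nonneg hc (hρ x))]
    exact ENNReal.ofReal_le_ofReal (hle x)
  rw [ENNReal.ofReal_sub _ (by positivity)]
  exact ENNReal.le_sub_of_add_le_right ENNReal.ofReal_ne_top key

end Expectation

/-! ### Number of calls of an extractor -/

namespace Extractor

variable {K L : Type*} [Field K] [Field L] [Algebra K L] {n k r D : ℕ}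
  {Seed Salt Rnd Cmt Dig Tape : Type*}
  (E : Extractor L n k D)
  (F : Type*) [Field F] [Fintype F] [Algebra F K] [Module.Finite F K]
  (S : Primitives K L k r D Seed Salt Rnd Cmt Dig) (I : Instance K n k)
  (P : Prover K L n k r D Seed Salt Cmt Dig Tape)

variable {F S I P} in
theorem valid_of_output_eq_some {h : List (Query L n k D × Tape)}
    {o : Output K L n k r D Seed Rnd Cmt Dig} (ho : output F S I P h = some o) :
    o.Valid F S I := by
  simpa using List.find?_some ho

variable {F S I P} in
theorem not_valid_of_output_eq_none {h : List (Query L n k D × Tape)}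
    (ho : output F S I P h = none) {T T' : Transcript K L n k r D Seed Salt Cmt Dig}
    (hT : T ∈ transcripts P h) (hT' : T' ∈ transcripts P h)
    {o : Output K L n k r D Seed Rnd Cmt Dig} (hm : o ∈ readOff S I (Fintype.card F) T T') :
    ¬ o.Valid F S I := by
  rw [output, List.find?_eq_none] at ho
  simpa using ho o (List.mem_flatMap.2 ⟨T, hT, List.mem_flatMap.2 ⟨T', hT', hm⟩⟩)

open Classical in
/-- Probability that the extractor has not halted within `t` calls. -/
def runningProb (t : ℕ) : ℝ≥0∞ :=
  expectation (E.run F S I P t) fun h => if (output F S I P h).isSome then 0 else 1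

theorem successProb_add_runningProb (t : ℕ) :
    E.successProb F S I P t + E.runningProb F S I P t = 1 := by
  classical
  rw [successProb, toOuterMeasure_eq_expectation, runningProb, ← expectation_add]
  refine Eq.trans ?_ (expectation_const (E.run F S I P t) 1)
  congr 1 with h
  obtain ho | ⟨o, ho⟩ := Option.eq_none_or_eq_some (output F S I P h)
  · simp [ho]
  · simp [ho, valid_of_output_eq_some ho]

theorem expectation_step_length (h : List (Query L n k D × Tape)) :
    expectation (E.step F S I P h) (fun h' => (h'.length : ℝ≥0∞))
      = h.length + if (output F S I P h).isSome then 0 else 1 := by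
  unfold step
  split_ifs
  · simp [expectation_pure]
  · simp [expectation_bind, expectation_map, expectation_const]

theorem expectation_run_length (t : ℕ) :
    expectation (E.run F S I P t) (fun h => (h.length : ℝ≥0∞))
      = ∑ s ∈ Finset.range t, E.runningProb F S I P s := by
  induction t with
  | zero => simp [run, expectation_pure]
  | succ t ih =>
    rw [run, expectation_bind, Finset.sum_range_succ, ← ih, runningProb, ← expectation_add]
    simp only [expectation_step_length]

theorem expectedCalls_eq_tsum_runningProb :
    E.expectedCalls F S I P = ∑' t, E.runningProb F S I P t := by
  rw [ENNReal.tsum_eq_iSup_nat]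
  exact iSup_congr (E.expectation_run_length F S I P)

variable {E F S I P}

theorem tendsto_successProb_of_expectedCalls_ne_top (h : E.expectedCalls F S I P ≠ ∞) :
    Filter.Tendsto (fun t => E.successProb F S I P t) Filter.atTop (𝓝 1) := by
  rw [expectedCalls_eq_tsum_runningProb] at h
  have hsub : (fun t => E.successProb F S I P t) = fun t => 1 - E.runningProb F S I P t := by
    funext t
    have hadd := E.successProb_add_runningProb F S I P t
    exact ENNReal.eq_sub_of_add_eq
      (ne_top_of_le_ne_top ENNReal.one_ne_top (hadd ▸ le_add_self)) hadd
  rw [hsub]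
  simpa using ENNReal.Tendsto.sub (tendsto_const_nhds (x := (1 : ℝ≥0∞)))
    (ENNReal.tendsto_atTop_zero_of_tsum_ne_top h) (Or.inl ENNReal.one_ne_top)

theorem expectedCalls_le_of_potential (Φ : List (Query L n k D × Tape) → ℝ≥0∞)
    (hΦ : ∀ h, output F S I P h = none → 1 + expectation (E.step F S I P h) Φ ≤ Φ h) :
    E.expectedCalls F S I P ≤ Φ [] := by
  have drift (t : ℕ) :
      expectation (E.run F S I P t) (fun h => (h.length : ℝ≥0∞) + Φ h) ≤ Φ [] := by
    induction t with
    | zero => simp [run, expectation_pure]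
    | succ t ih =>
      refine le_trans ?_ ih
      rw [run, expectation_bind]
      refine expectation_mono _ fun h => ?_
      rcases ho : output F S I P h with _ | o
      · rw [expectation_add, expectation_step_length, ho, add_assoc]
        exact add_le_add_right (by simpa using hΦ h ho) _
      · simp [step, ho, expectation_pure]
  exact iSup_le fun t => (expectation_mono _ fun _ => le_self_add).trans (drift t)

end Extractor

/-! ### Repeated trials -/

/-- Expected cost of at most `f` independent trials of unit cost and success probability `W`, when
`out` is to be paid after a success and `fail` if all trials fail. -/
def trialCost (W out fail : ℝ) : ℕ → ℝ
  | 0 => fail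
  | f + 1 => 1 + W * out + (1 - W) * trialCost W out fail f

theorem trialCost_eq (W out fail : ℝ) (f : ℕ) :
    trialCost W out fail f
      = ∑ j ∈ Finset.range f, (1 - W) ^ j + (1 - (1 - W) ^ f) * out + (1 - W) ^ f * fail := by
  induction f with
  | zero => simp [trialCost]
  | succ f ih =>
    rw [trialCost, ih, Finset.sum_range_succ']
    simp only [pow_succ, ← Finset.sum_mul]
    ring

theorem trialCost_nonneg {W out fail : ℝ} (hW₀ : 0 ≤ W) (hW₁ : W ≤ 1) (hout : 0 ≤ out)
    (hfail : 0 ≤ fail) (f : ℕ) : 0 ≤ trialCost W out fail f := by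
  induction f with
  | zero => exact hfail
  | succ f ih =>
    have : 0 ≤ 1 - W := sub_nonneg.2 hW₁
    rw [trialCost]
    positivity

theorem one_sub_one_sub_pow_nonneg {W : ℝ} (hW₀ : 0 ≤ W) (hW₁ : W ≤ 1) (B : ℕ) :
    0 ≤ 1 - (1 - W) ^ B :=
  sub_nonneg.2 (pow_le_one₀ (sub_nonneg.2 hW₁) (sub_le_self _ hW₀))

theorem div_le_one_sub_one_sub_pow {W : ℝ} (hW₀ : 0 ≤ W) (hW₁ : W ≤ 1) (B : ℕ) :
    B * W / (1 + B * W) ≤ 1 - (1 - W) ^ B := by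
  have bernoulli : 1 + B * W ≤ (1 + W) ^ B := one_add_mul_le_pow (by linarith) B
  have : 0 ≤ 1 - W := sub_nonneg.2 hW₁
  have hprod : (1 + B * W) * (1 - W) ^ B ≤ 1 := by
    calc (1 + B * W) * (1 - W) ^ B ≤ (1 + W) ^ B * (1 - W) ^ B := by gcongr
      _ = (1 - W ^ 2) ^ B := by rw [← mul_pow]; ring_nf
      _ ≤ 1 := pow_le_one₀ (by nlinarith) (by nlinarith)
  rw [div_le_iff₀ (by positivity)]
  linarith

/-- Slope of the tangent at `Δ` of the convex function `W ↦ B W ^ 2 / (1 + B W)`, where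
`κ = B Δ`. -/
def tangentSlope (κ : ℝ) : ℝ := κ * (2 + κ) / (1 + κ) ^ 2

/-- Minus the value at `0` of the tangent at `Δ` of `W ↦ B W ^ 2 / (1 + B W)`, where `κ = B Δ`. -/
def tangentOffset (κ Δ : ℝ) : ℝ := κ * Δ / (1 + κ) ^ 2

theorem tangentSlope_nonneg {κ : ℝ} (hκ : 0 ≤ κ) : 0 ≤ tangentSlope κ := by
  unfold tangentSlope
  positivity

theorem tangentOffset_nonneg {κ Δ : ℝ} (hκ : 0 ≤ κ) (hΔ : 0 ≤ Δ) : 0 ≤ tangentOffset κ Δ := by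
  unfold tangentOffset
  positivity

theorem tangent_le {B Δ W : ℝ} (hB : 0 ≤ B) (hΔ : 0 ≤ Δ) (hW : 0 ≤ W) :
    tangentSlope (B * Δ) * W - tangentOffset (B * Δ) Δ ≤ W * (B * W / (1 + B * W)) := by
  have hgap : W * (B * W / (1 + B * W)) - (tangentSlope (B * Δ) * W - tangentOffset (B * Δ) Δ)
      = B * (W - Δ) ^ 2 / ((1 + B * W) * (1 + B * Δ) ^ 2) := by
    unfold tangentSlope tangentOffset
    field_simp
    ring
  rw [← sub_nonneg, hgap]
  positivity

theorem tangent_self {κ Δ : ℝ} (hκ : 0 ≤ κ) :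
    tangentSlope κ * Δ - tangentOffset κ Δ = κ * Δ / (1 + κ) := by
  unfold tangentSlope tangentOffset
  field_simp
  ring

/-! ### Acceptance rates of the challenges -/

section Rate

variable {J : Type*} [Fintype J]

open Classical in
/-- Probability that a uniform challenge satisfies `a`. -/
def rate (a : J → Prop) : ℝ := 𝔼 i, if a i then 1 else 0

/-- Probability that a uniform challenge satisfies `a` and differs from a given one. The given
challenge is assumed to satisfy `a`, so that this probability does not depend on it. -/
def otherRate (a : J → Prop) : ℝ := max (rate a - 1 / Fintype.card J) 0

/-- Probability that a uniform challenge satisfies `a` and that one of `B` further ones also does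
and differs from it. -/
def pairRate (a : J → Prop) (B : ℕ) : ℝ := rate a * (1 - (1 - otherRate a) ^ B)

variable {a : J → Prop}

theorem rate_eq_expect [DecidablePred a] : rate a = 𝔼 i, if a i then 1 else 0 := by
  unfold rate
  congr!

theorem rate_nonneg : 0 ≤ rate a :=
  Finset.expect_nonneg fun i _ => by split_ifs <;> norm_num

theorem rate_le_one : rate a ≤ 1 := by
  cases isEmpty_or_nonempty J
  · simp [rate]
  · exact Finset.expect_le Finset.univ_nonempty fun i _ => by split_ifs <;> norm_num

theorem rate_pos {i : J} (hi : a i) : 0 < rate a :=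
  Finset.expect_pos' (fun i _ => by split_ifs <;> norm_num) ⟨i, Finset.mem_univ i, by simp [hi]⟩

theorem expect_ite_eq_rate [Nonempty J] [DecidablePred a] (x y : ℝ) :
    (𝔼 i, if a i then x else y) = rate a * x + (1 - rate a) * y := by
  have hite (i : J) : (if a i then x else y) = (if a i then 1 else 0) * (x - y) + y := by
    split_ifs <;> ring
  rw [Finset.expect_congr rfl fun i _ => hite i, Finset.expect_add_distrib, ← Finset.expect_mul,
    Fintype.expect_const, ← rate_eq_expect]
  ring

theorem rate_mem (s : Finset J) : rate (· ∈ s) = s.dens := by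
  classical
  rw [rate_eq_expect, Fintype.expect_eq_sum_div_card, Finset.sum_boole, Finset.nnratCast_dens]
  simp

theorem rate_and_ne {i : J} (hi : a i) : rate (fun j => a j ∧ j ≠ i) = otherRate a := by
  classical
  have hsplit (j : J) : (if a j ∧ j ≠ i then 1 else 0)
      = (if a j then 1 else 0) - (if j = i then 1 else 0 : ℝ) := by
    by_cases hj : j = i <;> simp [hj, hi]
  have hrate : rate (fun j => a j ∧ j ≠ i) = rate a - 1 / Fintype.card J := by
    rw [rate_eq_expect, Finset.expect_congr rfl fun j _ => hsplit j, Finset.expect_sub_distrib,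
      ← rate_eq_expect, Fintype.expect_ite_eq', NNRat.smul_one_eq_cast]
    simp
  rw [otherRate, ← hrate, max_eq_left rate_nonneg]

theorem otherRate_nonneg : 0 ≤ otherRate a := le_max_right _ _

theorem otherRate_le_rate : otherRate a ≤ rate a :=
  max_le (sub_le_self _ (by positivity)) rate_nonneg

theorem otherRate_le_one : otherRate a ≤ 1 := otherRate_le_rate.trans rate_le_one

theorem otherRate_pos {i j : J} (hi : a i) (hj : a j) (hij : i ≠ j) : 0 < otherRate a :=
  rate_and_ne hi ▸ rate_pos ⟨hj, hij.symm⟩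

theorem pairRate_nonneg (B : ℕ) : 0 ≤ pairRate a B :=
  mul_nonneg rate_nonneg (one_sub_one_sub_pow_nonneg otherRate_nonneg otherRate_le_one B)

theorem pairRate_pos {B : ℕ} (hB : B ≠ 0) {i j : J} (hi : a i) (hj : a j) (hij : i ≠ j) :
    0 < pairRate a B :=
  mul_pos (rate_pos hi) (sub_pos.2 (pow_lt_one₀ (sub_nonneg.2 otherRate_le_one)
    (sub_lt_self _ (otherRate_pos hi hj hij)) hB))

theorem tangent_le_pairRate {Δ : ℝ} (hΔ : 0 ≤ Δ) (B : ℕ) :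
    tangentSlope (B * Δ) * (rate a - 1 / Fintype.card J) - tangentOffset (B * Δ) Δ
      ≤ pairRate a B := by
  have hσ : 0 ≤ tangentSlope (B * Δ) := tangentSlope_nonneg (by positivity)
  calc tangentSlope (B * Δ) * (rate a - 1 / Fintype.card J) - tangentOffset (B * Δ) Δ
      ≤ tangentSlope (B * Δ) * otherRate a - tangentOffset (B * Δ) Δ := by
        gcongr
        exact le_max_left _ _
    _ ≤ otherRate a * (B * otherRate a / (1 + B * otherRate a)) :=
        tangent_le (by positivity) hΔ otherRate_nonneg
    _ ≤ otherRate a * (1 - (1 - otherRate a) ^ B) :=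
        mul_le_mul_of_nonneg_left
          (div_le_one_sub_one_sub_pow otherRate_nonneg otherRate_le_one B) otherRate_nonneg
    _ ≤ pairRate a B :=
        mul_le_mul_of_nonneg_right otherRate_le_rate
          (one_sub_one_sub_pow_nonneg otherRate_nonneg otherRate_le_one B)

theorem one_add_expectation_trialCost [Nonempty J] [DecidablePred a] [DecidableEq J] {i : J}
    (hi : a i) {out fail : ℝ} (hout : 0 ≤ out) (hfail : 0 ≤ fail) (f : ℕ) :
    1 + expectation (PMF.uniformOfFintype J) (fun j => ENNReal.ofReal
        (if a j ∧ j ≠ i then out else trialCost (otherRate a) out fail f))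
      = ENNReal.ofReal (trialCost (otherRate a) out fail (f + 1)) := by
  have hcost := trialCost_nonneg (otherRate_nonneg (a := a)) otherRate_le_one hout hfail f
  have hnonneg (j : J) : 0 ≤ if a j ∧ j ≠ i then out else trialCost (otherRate a) out fail f := by
    split_ifs <;> assumption
  rw [expectation_uniformOfFintype_ofReal hnonneg, ← ENNReal.ofReal_one,
    ← ENNReal.ofReal_add zero_le_one (Finset.expect_nonneg fun j _ => hnonneg j),
    expect_ite_eq_rate, rate_and_ne hi, trialCost, add_assoc]

end Rate

/-! ### Potentials of the extraction for a fixed random tape -/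

section Potential

variable {C J : Type*} [Fintype C] [Fintype J]

/-- Probability that uniform challenges satisfy `acc`. -/
def meanRate (acc : C → J → Prop) : ℝ := 𝔼 c, rate (acc c)

/-- Probability that uniform challenges are accepted, and that one of at most `B` repetitions with
the same first challenge is accepted with another second challenge. -/
def pairProb (acc : C → J → Prop) (B : ℕ) : ℝ := 𝔼 c, pairRate (acc c) B

/-- Expected number of calls of the experiment of `pairProb`. -/
def attemptCost (acc : C → J → Prop) (B : ℕ) : ℝ :=
  1 + 𝔼 c, rate (acc c) * ∑ j ∈ Finset.range B, (1 - otherRate (acc c)) ^ j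

/-- Expected cost of the experiment of `pairProb`, when `out c` is to be paid after a success with
first challenge `c`, and `fail` after a failure. -/
def attemptValue (acc : C → J → Prop) (B : ℕ) (out : C → ℝ) (fail : ℝ) : ℝ :=
  1 + 𝔼 c, (rate (acc c) * trialCost (otherRate (acc c)) (out c) fail B
    + (1 - rate (acc c)) * fail)

variable (J) in
/-- Acceptance probability attained by accepting all second challenges if the first one is in `G`,
and a single one otherwise. -/
def cheatingRate (G : Finset C) : ℝ := G.dens + (1 - G.dens) * (1 / Fintype.card J)

/-- Lower bound, affine in the acceptance probability where it does not vanish, for the part of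
`pairProb` that lies outside a set `G` of first challenges with `cheatingRate J G ≤ ε`. -/
def escapeProb (acc : C → J → Prop) (B : ℕ) (ε Δ : ℝ) : ℝ :=
  max 0 (tangentSlope (B * Δ) * (meanRate acc - ε) - tangentOffset (B * Δ) Δ)

/-- Potential after a first pair has been found, when `V` is the potential at the start. -/
def pairPotential (acc : C → J → Prop) (B : ℕ) (ε Δ V : ℝ) : ℝ :=
  (attemptCost acc B + (pairProb acc B - escapeProb acc B ε Δ) * V) / pairProb acc B

variable {acc : C → J → Prop}

theorem meanRate_nonneg : 0 ≤ meanRate acc := Finset.expect_nonneg fun _ _ => rate_nonneg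

theorem meanRate_le_one : meanRate acc ≤ 1 := by
  cases isEmpty_or_nonempty C
  · simp [meanRate]
  · exact Finset.expect_le Finset.univ_nonempty fun _ _ => rate_le_one

theorem pairProb_nonneg (B : ℕ) : 0 ≤ pairProb acc B :=
  Finset.expect_nonneg fun _ _ => pairRate_nonneg B

theorem pairProb_pos {B : ℕ} (hB : B ≠ 0) {c : C} {i j : J} (hi : acc c i) (hj : acc c j)
    (hij : i ≠ j) : 0 < pairProb acc B :=
  Finset.expect_pos' (fun _ _ => pairRate_nonneg B)
    ⟨c, Finset.mem_univ c, pairRate_pos hB hi hj hij⟩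

theorem escapeProb_nonneg (B : ℕ) (ε Δ : ℝ) : 0 ≤ escapeProb acc B ε Δ := le_max_left _ _

theorem attemptCost_nonneg (B : ℕ) : 0 ≤ attemptCost acc B :=
  add_nonneg zero_le_one <| Finset.expect_nonneg fun _ _ => mul_nonneg rate_nonneg <|
    Finset.sum_nonneg fun _ _ => pow_nonneg (sub_nonneg.2 otherRate_le_one) _

theorem attemptCost_le (B : ℕ) : attemptCost acc B ≤ 1 + meanRate acc * B := by
  rw [attemptCost, meanRate, Finset.expect_mul]
  refine add_le_add_right (Finset.expect_le_expect fun c _ =>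
    mul_le_mul_of_nonneg_left ?_ rate_nonneg) 1
  calc ∑ j ∈ Finset.range B, (1 - otherRate (acc c)) ^ j
      ≤ ∑ _j ∈ Finset.range B, (1 : ℝ) := Finset.sum_le_sum fun _ _ =>
        pow_le_one₀ (sub_nonneg.2 otherRate_le_one) (sub_le_self _ otherRate_nonneg)
    _ = B := by simp

theorem attemptValue_eq [Nonempty C] (B : ℕ) (out : C → ℝ) (fail : ℝ) :
    attemptValue acc B out fail
      = fail + attemptCost acc B + (𝔼 c, pairRate (acc c) B * out c) - pairProb acc B * fail := by
  have hsplit (c : C) :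
      rate (acc c) * trialCost (otherRate (acc c)) (out c) fail B + (1 - rate (acc c)) * fail
        = rate (acc c) * ∑ j ∈ Finset.range B, (1 - otherRate (acc c)) ^ j
          + pairRate (acc c) B * out c + (fail - pairRate (acc c) B * fail) := by
    rw [trialCost_eq, pairRate]
    ring
  rw [attemptValue, Finset.expect_congr rfl fun c _ => hsplit c, Finset.expect_add_distrib,
    Finset.expect_add_distrib, Finset.expect_sub_distrib, Fintype.expect_const,
    ← Finset.expect_mul, attemptCost, pairProb]
  ring

theorem attemptValue_nonneg {B : ℕ} {out : C → ℝ} {fail : ℝ} (hout : ∀ c, 0 ≤ out c)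
    (hfail : 0 ≤ fail) : 0 ≤ attemptValue acc B out fail :=
  add_nonneg zero_le_one <| Finset.expect_nonneg fun c _ => add_nonneg
    (mul_nonneg rate_nonneg
      (trialCost_nonneg otherRate_nonneg otherRate_le_one (hout c) hfail B))
    (mul_nonneg (sub_nonneg.2 rate_le_one) hfail)

open Classical in
theorem one_add_expectation_attempt [Nonempty C] [Nonempty J] (B : ℕ) {out : C → ℝ} {fail : ℝ}
    (hout : ∀ c, 0 ≤ out c) (hfail : 0 ≤ fail) :
    1 + expectation (PMF.uniformOfFintype (C × J)) (fun x => ENNReal.ofReal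
        (if acc x.1 x.2 then trialCost (otherRate (acc x.1)) (out x.1) fail B else fail))
      = ENNReal.ofReal (attemptValue acc B out fail) := by
  have hnonneg (x : C × J) :
      0 ≤ if acc x.1 x.2 then trialCost (otherRate (acc x.1)) (out x.1) fail B else fail := by
    split_ifs
    exacts [trialCost_nonneg otherRate_nonneg otherRate_le_one (hout _) hfail B, hfail]
  rw [expectation_uniformOfFintype_ofReal hnonneg, ← ENNReal.ofReal_one,
    ← ENNReal.ofReal_add zero_le_one (Finset.expect_nonneg fun x _ => hnonneg x),
    ← Finset.univ_product_univ, Finset.expect_product, attemptValue]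
  simp only [expect_ite_eq_rate]

theorem tangent_le_pairProb_sub [Nonempty C] [DecidableEq C] {Δ : ℝ} (hΔ : 0 ≤ Δ) (B : ℕ)
    (G : Finset C) :
    tangentSlope (B * Δ) * (meanRate acc - cheatingRate J G) - tangentOffset (B * Δ) Δ
      ≤ pairProb acc B - 𝔼 c, if c ∈ G then pairRate (acc c) B else 0 := by
  set σ := tangentSlope (B * Δ)
  set τ := tangentOffset (B * Δ) Δ
  set ν : ℝ := 1 / Fintype.card J
  have hσ : 0 ≤ σ := tangentSlope_nonneg (by positivity)
  have hτ : 0 ≤ τ := tangentOffset_nonneg (by positivity) hΔ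
  have pointwise (c : C) : σ * (rate (acc c) - ν) - τ - (if c ∈ G then σ * (1 - ν) else 0)
      ≤ pairRate (acc c) B - if c ∈ G then pairRate (acc c) B else 0 := by
    split_ifs
    · have := mul_le_mul_of_nonneg_left (rate_le_one (a := acc c)) hσ
      linarith
    · simpa only [sub_zero] using tangent_le_pairRate hΔ B
  have average : (𝔼 c, (σ * (rate (acc c) - ν) - τ - (if c ∈ G then σ * (1 - ν) else 0)))
      = σ * (meanRate acc - cheatingRate J G) - τ := by
    rw [Finset.expect_sub_distrib, Finset.expect_sub_distrib, ← Finset.mul_expect,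
      Finset.expect_sub_distrib, Fintype.expect_const, Fintype.expect_const, expect_ite_eq_rate,
      rate_mem, ← meanRate, cheatingRate]
    ring
  rw [← average, pairProb, ← Finset.expect_sub_distrib]
  exact Finset.expect_le_expect fun c _ => pointwise c

theorem expect_pairRate_mem_le [Nonempty C] [DecidableEq C] {ε Δ : ℝ} (hΔ : 0 ≤ Δ) (B : ℕ)
    {G : Finset C} (hG : cheatingRate J G ≤ ε) :
    (𝔼 c, if c ∈ G then pairRate (acc c) B else 0)
      ≤ pairProb acc B - escapeProb acc B ε Δ := by
  have hσ : 0 ≤ tangentSlope (B * Δ) := tangentSlope_nonneg (by positivity)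
  rw [le_sub_comm]
  refine max_le (sub_nonneg.2 (Finset.expect_le_expect fun c _ => ?_))
    (le_trans ?_ (tangent_le_pairProb_sub hΔ B G))
  · split_ifs
    exacts [le_rfl, pairRate_nonneg B]
  · gcongr

theorem escapeProb_le_pairProb [Nonempty C] {ε Δ : ℝ} (hΔ : 0 ≤ Δ)
    (hε : 1 / Fintype.card J ≤ ε) (B : ℕ) : escapeProb acc B ε Δ ≤ pairProb acc B := by
  classical
  simpa using expect_pairRate_mem_le (acc := acc) (G := ∅) hΔ B (by simpa [cheatingRate] using hε)

theorem pairPotential_nonneg [Nonempty C] {ε Δ V : ℝ} (hΔ : 0 ≤ Δ)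
    (hε : 1 / Fintype.card J ≤ ε) (hV : 0 ≤ V) (B : ℕ) : 0 ≤ pairPotential acc B ε Δ V :=
  div_nonneg (add_nonneg (attemptCost_nonneg B)
    (mul_nonneg (sub_nonneg.2 (escapeProb_le_pairProb hΔ hε B)) hV)) (pairProb_nonneg B)

theorem pairProb_mul_pairPotential {B : ℕ} (hπ : pairProb acc B ≠ 0) (ε Δ V : ℝ) :
    pairProb acc B * pairPotential acc B ε Δ V
      = attemptCost acc B + (pairProb acc B - escapeProb acc B ε Δ) * V :=
  mul_div_cancel₀ _ hπ

theorem attemptValue_pairPotential_le [Nonempty C] [DecidableEq C] {ε Δ V : ℝ}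
    (hΔ : 0 ≤ Δ) (hV : 0 ≤ V) {B : ℕ} {G : Finset C} (hG : cheatingRate J G ≤ ε)
    (hπ : pairProb acc B ≠ 0) :
    attemptValue acc B (fun c => if c ∈ G then V else 0) (pairPotential acc B ε Δ V)
      ≤ pairPotential acc B ε Δ V := by
  have hout : (𝔼 c, pairRate (acc c) B * if c ∈ G then V else 0)
      = (𝔼 c, if c ∈ G then pairRate (acc c) B else 0) * V := by
    simp only [Finset.expect_mul, mul_ite, ite_mul, mul_zero, zero_mul]
  rw [attemptValue_eq, pairProb_mul_pairPotential hπ, hout]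
  linarith [mul_le_mul_of_nonneg_right (expect_pairRate_mem_le (acc := acc) hΔ B hG) hV]

theorem attemptValue_start_le [Nonempty C] {ε Δ : ℝ} (hΔ : 0 ≤ Δ)
    (hε : 1 / Fintype.card J ≤ ε) (V : ℝ) (B : ℕ) :
    attemptValue acc B (fun _ => pairPotential acc B ε Δ V) V
      ≤ V + 2 * attemptCost acc B - escapeProb acc B ε Δ * V := by
  rw [attemptValue_eq, ← Finset.expect_mul, ← pairProb]
  by_cases hπ : pairProb acc B = 0
  · have hesc : escapeProb acc B ε Δ = 0 :=
      le_antisymm ((escapeProb_le_pairProb hΔ hε B).trans_eq hπ) (escapeProb_nonneg B ε Δ)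
    rw [hπ, hesc]
    linarith [attemptCost_nonneg (acc := acc) B]
  · rw [pairProb_mul_pairPotential hπ]
    linarith

end Potential

/-! ### Choice of the number of repetitions -/

/-- Number of repetitions with the same first challenge, for an advantage `Δ`. -/
def repetitions (Δ : ℝ) : ℕ := ⌈1 / Δ⌉₊

/-- Bound for the expected number of calls with `B` repetitions, for an advantage `Δ` and an
acceptance probability `εt`. -/
def startPotential (B : ℕ) (Δ εt : ℝ) : ℝ := 2 * (1 + εt * B) * (1 + B * Δ) / (B * Δ * Δ)

theorem repetitions_pos {Δ : ℝ} (hΔ : 0 < Δ) : 0 < repetitions Δ :=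
  Nat.ceil_pos.2 (by positivity)

theorem startPotential_nonneg {Δ εt : ℝ} (hΔ : 0 ≤ Δ) (hεt : 0 ≤ εt) (B : ℕ) :
    0 ≤ startPotential B Δ εt := by
  unfold startPotential
  positivity

theorem one_div_repetitions_add_le {Δ εt : ℝ} (hΔ : 0 < Δ) (hΔεt : Δ ≤ εt) (hεt : εt ≤ 1) :
    1 / repetitions Δ + εt * (repetitions Δ * Δ) ≤ Δ + 1.77 * εt := by
  have hB : (0 : ℝ) < repetitions Δ := mod_cast repetitions_pos hΔ
  have hle : 1 ≤ repetitions Δ * Δ := (div_le_iff₀ hΔ).1 (Nat.le_ceil _)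
  have hlt : repetitions Δ * Δ < 1 + Δ := by
    have := mul_lt_mul_of_pos_right (Nat.ceil_lt_add_one (one_div_nonneg.2 hΔ.le)) hΔ
    rwa [add_mul, one_div_mul_cancel hΔ.ne', one_mul] at this
  rcases le_or_gt Δ 0.77 with hsmall | hlarge
  · have hinv : 1 / (repetitions Δ : ℝ) ≤ Δ := by rwa [div_le_iff₀' hB]
    nlinarith
  · have hcases : repetitions Δ = 1 ∨ repetitions Δ = 2 := by
      have hle_two : repetitions Δ ≤ 2 :=
        Nat.ceil_le.2 (by rw [div_le_iff₀ hΔ]; push_cast; linarith)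
      have := repetitions_pos hΔ
      omega
    rcases hcases with h | h <;> rw [h] at hle ⊢ <;> push_cast at hle ⊢ <;> nlinarith

theorem startPotential_le {Δ εt : ℝ} (hΔ : 0 < Δ) (hΔεt : Δ ≤ εt) (hεt : εt ≤ 1) :
    startPotential (repetitions Δ) Δ εt ≤ 4 / Δ * (1 + 2 * εt * Real.log 2 / Δ) := by
  have hB : (0 : ℝ) < repetitions Δ := mod_cast repetitions_pos hΔ
  have hstart : startPotential (repetitions Δ) Δ εt
      = 2 * (1 / repetitions Δ + εt * (repetitions Δ * Δ) + Δ + εt) / Δ ^ 2 := by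
    unfold startPotential
    field_simp
    ring
  have hbound : 4 / Δ * (1 + 2 * εt * Real.log 2 / Δ)
      = 2 * (2 * Δ + 4 * Real.log 2 * εt) / Δ ^ 2 := by
    field_simp
    ring
  rw [hstart, hbound]
  gcongr 2 * ?_ / _
  nlinarith [one_div_repetitions_add_le hΔ hΔεt hεt, Real.log_two_gt_d9]

theorem two_mul_one_add_mul_le {B : ℕ} (hB : 0 < B) {ε Δ εt a : ℝ} (hΔ : 0 < Δ) (hε : 0 ≤ ε)
    (hεt : εt = ε + Δ) (ha : εt ≤ a) :
    2 * (1 + B * a) ≤ startPotential B Δ εt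
      * (tangentSlope (B * Δ) * (a - ε) - tangentOffset (B * Δ) Δ) := by
  have : (0 : ℝ) < B := mod_cast hB
  set V := startPotential B Δ εt
  have at_threshold : V * (tangentSlope (B * Δ) * Δ - tangentOffset (B * Δ) Δ)
      = 2 * (1 + εt * B) := by
    rw [tangent_self (by positivity)]
    unfold V startPotential
    field_simp
  have slope : 2 * B ≤ V * tangentSlope (B * Δ) := by
    have hslope : V * tangentSlope (B * Δ)
        = 2 * (1 + εt * B) * (2 + B * Δ) / (Δ * (1 + B * Δ)) := by
      unfold V startPotential tangentSlope
      field_simp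
    have hκ : B * Δ ≤ 1 + εt * B := by nlinarith
    have hprod : B * Δ * (1 + B * Δ) ≤ (1 + εt * B) * (2 + B * Δ) := by
      gcongr
      · exact hκ.trans' (by positivity)
      · norm_num
    rw [hslope, le_div_iff₀ (by positivity)]
    linarith
  nlinarith [mul_le_mul_of_nonneg_right slope (sub_nonneg.2 ha)]

/-! ### Rank weight and `q`-polynomials -/

section QPoly

variable (F : Type*) {K : Type*} [Field F] [Field K] [Algebra F K]

theorem rankWeight_eq_finrank_span [Module.Finite F K] {ι : Type*} [Finite ι] (x : ι → K) :
    rankWeight F x = Module.finrank F (Submodule.span F (Set.range x)) := by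
  set e := (Module.finBasis F K).equivFun
  have hrow : Set.range (Matrix.of fun i j => (Module.finBasis F K).repr (x i) j).row
      = e.toLinearMap '' Set.range x := by
    rw [← Set.range_comp]
    rfl
  rw [rankWeight, Matrix.rank_eq_finrank_span_row, hrow, ← Submodule.map_span]
  exact LinearEquiv.finrank_map_eq e _

variable [Fintype F] {s : ℕ}

/-- The `q`-polynomial `X ^ (q ^ r) - X + ∑ e, β e (X ^ (q ^ (e + 1)) - X)`, as a linear map. -/
def qPoly (r : ℕ) (β : Fin s → K) : K →ₗ[F] K :=
  (FiniteField.frobeniusAlgHom F K ^ r).toLinearMap - LinearMap.id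
    + ∑ e, LinearMap.mulLeft F (β e) ∘ₗ
      ((FiniteField.frobeniusAlgHom F K ^ (e.val + 1)).toLinearMap - LinearMap.id)

theorem frobeniusAlgHom_pow_apply (e : ℕ) (x : K) :
    (FiniteField.frobeniusAlgHom F K ^ e) x = x ^ Fintype.card F ^ e := by
  rw [AlgHom.coe_pow, FiniteField.coe_frobeniusAlgHom, pow_iterate]

theorem qPoly_apply (r : ℕ) (β : Fin s → K) (x : K) :
    qPoly F r β x = x ^ Fintype.card F ^ r - x
      + ∑ e, β e * (x ^ Fintype.card F ^ (e.val + 1) - x) := by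
  simp [qPoly, frobeniusAlgHom_pow_apply]

open Polynomial in
theorem exists_monic_eval_eq_qPoly {r : ℕ} (hs : s < r) (β : Fin s → K) :
    ∃ f : K[X], f.Monic ∧ f.natDegree = Fintype.card F ^ r ∧ ∀ x, f.eval x = qPoly F r β x := by
  set q := Fintype.card F
  have hq : 1 < q := Fintype.one_lt_card
  set g : K[X] := ∑ e, C (β e) * (X ^ q ^ (e.val + 1) - X) - X
  have hX : (X : K[X]).degree < (q ^ r : ℕ) := by
    rw [degree_X]
    exact_mod_cast Nat.one_lt_pow (by omega) hq
  have hterm (e : Fin s) : degree (C (β e) * (X ^ q ^ (e.val + 1) - X)) < (q ^ r : ℕ) := by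
    rw [← smul_eq_C_mul]
    refine (degree_smul_le _ _).trans_lt ((degree_sub_le _ _).trans_lt (max_lt ?_ hX))
    rw [degree_X_pow]
    exact_mod_cast Nat.pow_lt_pow_right hq (by omega)
  have hg : g.degree < (q ^ r : ℕ) :=
    (degree_sub_le _ _).trans_lt <| max_lt ((degree_sum_le _ _).trans_lt <|
      (Finset.sup_lt_iff (WithBot.bot_lt_coe _)).2 fun e _ => hterm e) hX
  refine ⟨X ^ q ^ r + g, monic_X_pow_add hg, ?_, fun x => ?_⟩
  · rw [natDegree_add_eq_left_of_degree_lt (by rwa [degree_X_pow]), natDegree_X_pow]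
  · rw [qPoly_apply]
    simp only [g, eval_add, eval_sub, eval_pow, eval_X, eval_finsetSum, eval_mul, eval_C]
    ring

theorem finrank_ker_qPoly_le {r : ℕ} (hs : s < r) (β : Fin s → K) :
    Module.finrank F (LinearMap.ker (qPoly F r β)) ≤ r := by
  classical
  obtain ⟨f, hmonic, hdeg, heval⟩ := exists_monic_eval_eq_qPoly F hs β
  have hker : (LinearMap.ker (qPoly F r β) : Set K) = f.roots.toFinset := by
    ext x
    simp [hmonic.ne_zero, heval]
  have : Finite (LinearMap.ker (qPoly F r β)) := (hker ▸ Finset.finite_toSet _ : Set.Finite _)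
  have hcard : Nat.card (LinearMap.ker (qPoly F r β)) ≤ Fintype.card F ^ r := by
    rw [← hdeg, ← SetLike.coe_sort_coe, hker, Nat.card_coe_set_eq, Set.ncard_coe_finset]
    exact (Multiset.toFinset_card_le _).trans f.card_roots'
  rw [Module.natCard_eq_pow_finrank (K := F), Nat.card_eq_fintype_card] at hcard
  exact (Nat.pow_le_pow_iff_right Fintype.one_lt_card).1 hcard

theorem rankWeight_le_of_qPoly_eq_zero [Module.Finite F K] {ι : Type*} [Finite ι] {r : ℕ}
    (hs : s < r) {β : Fin s → K} {x : ι → K} (hx : ∀ i, qPoly F r β (x i) = 0) :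
    rankWeight F x ≤ r := by
  rw [rankWeight_eq_finrank_span]
  refine (Submodule.finrank_mono (Submodule.span_le.2 ?_)).trans (finrank_ker_qPoly_le F hs β)
  rintro _ ⟨i, rfl⟩
  exact hx i

end QPoly

/-! ### The false positive rate -/

section FalsePositive

theorem rate_apply_eq {M N : Type*} [AddGroup M] [Fintype M] [AddGroup N] [Fintype N]
    (f : M →+ N) (hf : Function.Surjective f) (u : N) :
    rate (fun x => f x = u) = 1 / Fintype.card N := by
  classical
  have hfiber (v : N) : rate (fun x => f x = v) = rate (fun x => f x = u) := by
    simp only [rate_eq_expect, Fintype.expect_eq_sum_div_card, Finset.sum_boole,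
      AddMonoidHom.card_fiber_eq_of_mem_range f (hf v) (hf u)]
  have htotal : ∑ v, rate (fun x => f x = v) = 1 := by
    simp only [rate_eq_expect, ← Finset.expect_sum_comm, Finset.sum_ite_eq, Finset.mem_univ,
      if_true, Fintype.expect_const]
  rw [Finset.sum_congr rfl fun v _ => hfiber v, Finset.sum_const, Finset.card_univ,
    nsmul_eq_mul] at htotal
  exact eq_one_div_of_mul_eq_one_right htotal

variable {L ι : Type*} [Field L] [Fintype L] [Fintype ι] [DecidableEq ι] {y : ι → L}

theorem rate_sum_mul_eq (hy : y ≠ 0) (u : L) :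
    rate (fun γ : ι → L => ∑ j, γ j * y j = u) = 1 / Fintype.card L := by
  have hsurj : Function.Surjective (Fintype.linearCombination L y) := by
    refine LinearMap.surjective fun h => hy (funext fun j => ?_)
    simpa using LinearMap.congr_fun h (Pi.single j 1)
  exact rate_apply_eq (Fintype.linearCombination L y).toAddMonoidHom hsurj u

theorem rate_mul_sum_eq_le (hy : y ≠ 0) (u : L) :
    rate (fun ch : (ι → L) × L => ch.2 * ∑ j, ch.1 j * y j = u)
      ≤ 2 / Fintype.card L - 1 / (Fintype.card L : ℝ) ^ 2 := by
  classical
  have hfiber (e : L) : rate (fun γ : ι → L => e * ∑ j, γ j * y j = u)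
      ≤ if e = 0 then 1 else 1 / (Fintype.card L : ℝ) := by
    split_ifs with he
    · exact rate_le_one
    · simp only [← eq_inv_mul_iff_mul_eq₀ he, rate_sum_mul_eq hy, le_refl]
  calc rate (fun ch : (ι → L) × L => ch.2 * ∑ j, ch.1 j * y j = u)
      = 𝔼 e, rate (fun γ : ι → L => e * ∑ j, γ j * y j = u) := by
        simp only [rate_eq_expect, ← Finset.univ_product_univ, Finset.expect_product]
        exact Finset.expect_comm _ _ _
    _ ≤ 𝔼 e : L, if e = 0 then 1 else 1 / (Fintype.card L : ℝ) :=
        Finset.expect_le_expect fun e _ => hfiber e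
    _ = 2 / Fintype.card L - 1 / (Fintype.card L : ℝ) ^ 2 := by
        have hzero : rate (fun e : L => e = 0) = 1 / Fintype.card L :=
          rate_apply_eq (AddMonoidHom.id L) Function.surjective_id 0
        rw [expect_ite_eq_rate, hzero]
        ring

end FalsePositive

/-! ### Linearity of the computation on shares -/

section Linear

variable {F K L : Type*} [Field F] [Field K] [Algebra F K] [Field L] [Algebra K L] {n k r : ℕ}

instance : Add (Share K L k r) :=
  ⟨fun s s' => ⟨s.xB + s'.xB, s.β + s'.β, s.a + s'.a, s.c + s'.c⟩⟩

theorem fullVec_isWitness_iff [Module.Finite F K] (I : Instance K n k) (xB : Fin k → K) (r : ℕ) :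
    I.IsWitness F r (fullVec I True xB) ↔ rankWeight F (fullVec I True xB) ≤ r := by
  refine and_iff_right ?_
  rw [Instance.H, fullVec, Matrix.fromCols_mulVec]
  funext i
  simp [Function.comp_def]

theorem fullVec_add_not (I : Instance K n k) (b : Bool) (x x' : Fin k → K) :
    fullVec I (b = true) x + fullVec I ((!b) = true) x' = fullVec I True (x + x') := by
  funext j
  rcases j with j | j <;> cases b <;> simp [fullVec, Matrix.mulVec_add] <;> ring

variable (F) [Fintype F]

theorem frobSum_add (γ : Coord n k → L) (x x' : Coord n k → K) (e : ℕ) :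
    frobSum (Fintype.card F) γ (x + x') e
      = frobSum (Fintype.card F) γ x e + frobSum (Fintype.card F) γ x' e := by
  simp only [frobSum, Pi.add_apply, ← frobeniusAlgHom_pow_apply F, map_add, map_sub,
    ← Finset.sum_add_distrib]
  exact Finset.sum_congr rfl fun j _ => by ring

theorem alphaShare_add (I : Instance K n k) (ch : Ch1 L n k) (b : Bool) (s s' : Share K L k r) :
    alphaShare (Fintype.card F) I ch (b = true) s
        + alphaShare (Fintype.card F) I ch ((!b) = true) s'
      = alphaShare (Fintype.card F) I ch True (s + s') := by
  funext e
  have ha : (s + s').a e = s.a e + s'.a e := rfl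
  have hxB : (s + s').xB = s.xB + s'.xB := rfl
  simp only [alphaShare, Pi.add_apply, ha, hxB, ← fullVec_add_not I b, frobSum_add]
  ring

theorem vShare_add (I : Instance K n k) (ch : Ch1 L n k) (b : Bool) (α : Fin (r - 1) → L)
    (s s' : Share K L k r) :
    vShare (Fintype.card F) I ch (b = true) α s + vShare (Fintype.card F) I ch ((!b) = true) α s'
      = vShare (Fintype.card F) I ch True α (s + s') := by
  have hβ (e : Fin (r - 1)) : (s + s').β e = s.β e + s'.β e := rfl
  have hc : (s + s').c = s.c + s'.c := rfl
  have hxB : (s + s').xB = s.xB + s'.xB := rfl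
  simp only [vShare, hβ, hc, hxB, ← fullVec_add_not I b, frobSum_add, map_add, mul_add,
    Finset.sum_add_distrib]
  ring

/-- The value of `v` in an execution on unshared data: the sum of the shares of `v` that arise from
any sharing of `s`. -/
def vValue (q : ℕ) (I : Instance K n k) (s : Share K L k r) (ch : Ch1 L n k) : L :=
  vShare q I ch True (alphaShare q I ch True s) s

theorem vValue_eq (I : Instance K n k) (s : Share K L k r) (ch : Ch1 L n k) :
    vValue (Fintype.card F) I s ch
      = -(ch.2 * ∑ j, ch.1 j * algebraMap K L (qPoly F r s.β (fullVec I True s.xB j)))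
        - (∑ e, s.a e * algebraMap K L (s.β e)) - s.c := by
  set x := fullVec I True s.xB
  set q := Fintype.card F
  have hswap : ∑ e, ch.2 * frobSum q ch.1 x (e.val + 1) * algebraMap K L (s.β e)
      = ch.2 * ∑ j, ch.1 j
        * ∑ e, algebraMap K L (s.β e) * algebraMap K L (x j ^ q ^ (e.val + 1) - x j) := by
    simp only [frobSum, Finset.mul_sum, Finset.sum_mul]
    rw [Finset.sum_comm]
    exact Finset.sum_congr rfl fun j _ => Finset.sum_congr rfl fun e _ => by ring
  have hq : ∑ j, ch.1 j * algebraMap K L (qPoly F r s.β (x j))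
      = frobSum q ch.1 x r + ∑ j, ch.1 j
        * ∑ e, algebraMap K L (s.β e) * algebraMap K L (x j ^ q ^ (e.val + 1) - x j) := by
    simp only [qPoly_apply, map_add, map_sum, map_mul, mul_add, Finset.sum_add_distrib, frobSum, q]
  have hα : ∑ e, alphaShare q I ch True s e * algebraMap K L (s.β e)
      = ∑ e, ch.2 * frobSum q ch.1 x (e.val + 1) * algebraMap K L (s.β e)
        + ∑ e, s.a e * algebraMap K L (s.β e) := by
    simp only [alphaShare, add_mul, Finset.sum_add_distrib, x]
  rw [vValue, vShare, hα, hswap, hq]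
  ring

theorem rate_vValue_eq_zero_le [Module.Finite F K] [Fintype L] (hr : 1 ≤ r) (I : Instance K n k)
    (s : Share K L k r) (hs : ¬ I.IsWitness F r (fullVec I True s.xB)) :
    rate (fun ch : Ch1 L n k => vValue (Fintype.card F) I s ch = 0)
      ≤ 2 / Fintype.card L - 1 / (Fintype.card L : ℝ) ^ 2 := by
  set y : Coord n k → L := fun j => algebraMap K L (qPoly F r s.β (fullVec I True s.xB j))
  have hy : y ≠ 0 := fun h => hs <| (fullVec_isWitness_iff I s.xB r).2 <|
    rankWeight_le_of_qPoly_eq_zero F (Nat.sub_lt hr one_pos) fun j =>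
      (map_eq_zero_iff _ (algebraMap K L).injective).1 (congrFun h j)
  have hsolve (ch : Ch1 L n k) : vValue (Fintype.card F) I s ch = 0
      ↔ ch.2 * ∑ j, ch.1 j * y j = -(∑ e, s.a e * algebraMap K L (s.β e)) - s.c := by
    rw [vValue_eq F]
    constructor <;> intro h <;> linear_combination -h
  simp only [hsolve]
  exact rate_mul_sum_eq_le hy _

end Linear

/-! ### Consistency of accepted transcripts -/

section MainParty

variable {K L : Type*} [Field K] [Field L] {n k r D : ℕ} {Seed Salt Rnd Cmt Dig : Type*}

theorem sum_filter_ne_subtype {M : Type*} [AddCommMonoid M] {i : Leaf D} {d : Fin D} {b : Bool}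
    (hb : i d ≠ b) (g : Leaf D → M) :
    ∑ j : {j : Leaf D // j ≠ i} with j.1 d = b, g j.1 = ∑ j : Leaf D with j d = b, g j := by
  refine Finset.sum_bij (fun j _ => j.1) (fun j hj => ?_) (fun j _ j' _ => Subtype.ext)
    (fun j hj => ?_) fun _ _ => rfl
  · simpa using hj
  · simp only [Finset.mem_filter_univ] at hj
    exact ⟨⟨j, fun h => hb (h ▸ hj)⟩, by simpa using hj, rfl⟩

theorem Transcript.mainShare_eq_sum {S : Primitives K L k r D Seed Salt Rnd Cmt Dig}
    {T : Transcript K L n k r D Seed Salt Cmt Dig} {s : Leaf D → Share K L k r}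
    (hs : ∀ j, T.share S j = s j.1) {d : Fin D} {b : Bool} (hb : T.ch2 d ≠ b) :
    T.mainShare S d b = Share.sum {j | j d = b} s := by
  simp only [Transcript.mainShare, Share.sum, hs]
  rw [sum_filter_ne_subtype hb fun j => (s j).xB, sum_filter_ne_subtype hb fun j => (s j).β,
    sum_filter_ne_subtype hb fun j => (s j).a, sum_filter_ne_subtype hb fun j => (s j).c]

theorem Share.sum_filter_add_sum_filter_not (s : Leaf D → Share K L k r) (d : Fin D) (b : Bool) :
    Share.sum {j | j d = b} s + Share.sum {j | j d = !b} s = Share.sum Finset.univ s := by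
  simp only [Bool.eq_not]
  ext1 <;> exact Finset.sum_filter_add_sum_filter_not _ _ _

theorem sum_bool_eq_add_not {M : Type*} [AddCommMonoid M] (f : Bool → M) (b : Bool) :
    ∑ b', f b' = f b + f (!b) := by
  cases b <;> simp [add_comm]

variable (S : Primitives K L k r D Seed Salt Rnd Cmt Dig)
  (T₁ T₂ : Transcript K L n k r D Seed Salt Cmt Dig)

/-- The shares of all the leaves, read from two transcripts with distinct hidden leaves. -/
def jointShare (hne : T₁.ch2 ≠ T₂.ch2) (j : Leaf D) : Share K L k r :=
  if hj : j ≠ T₁.ch2 then T₁.share S ⟨j, hj⟩ else T₂.share S ⟨j, by rwa [not_not.1 hj]⟩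

theorem jointShare_sum_xB (hne : T₁.ch2 ≠ T₂.ch2) :
    (Share.sum Finset.univ (jointShare S T₁ T₂ hne)).xB
      = (∑ j, (T₁.share S j).xB) + (T₂.share S ⟨T₁.ch2, hne⟩).xB := by
  have hopened (j : {j : Leaf D // j ≠ T₁.ch2}) : T₁.share S j = jointShare S T₁ T₂ hne j.1 := by
    rw [jointShare, dif_pos j.2]
  have hhidden : T₂.share S ⟨T₁.ch2, hne⟩ = jointShare S T₁ T₂ hne T₁.ch2 := by
    rw [jointShare, dif_neg (not_not.2 rfl)]
  simp only [hopened, hhidden, add_comm _ (jointShare S T₁ T₂ hne T₁.ch2).xB]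
  exact Fintype.sum_eq_add_sum_subtype_ne (fun j => (jointShare S T₁ T₂ hne j).xB) T₁.ch2

end MainParty

section Consistency

variable (F : Type*) {K L : Type*} [Field F] [Fintype F] [Field K] [Algebra F K]
  [Module.Finite F K] [Field L] [Algebra K L] {n k r D : ℕ} {Seed Salt Rnd Cmt Dig : Type*}
  (S : Primitives K L k r D Seed Salt Rnd Cmt Dig) (I : Instance K n k)
  (T T' T₁ T₂ : Transcript K L n k r D Seed Salt Cmt Dig)

/-- No valid output can be read off from the two transcripts. -/
def NoOutput : Prop :=
  ∀ o ∈ readOff S I (Fintype.card F) T T', ¬ o.Valid F S I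

variable {F S I T T' T₁ T₂}

namespace NoOutput

theorem cmts_eq (h : NoOutput F S I T T') (hT : T.Accepts S I (Fintype.card F))
    (hT' : T'.Accepts S I (Fintype.card F)) (h0 : T.h0 = T'.h0) : T.cmts S = T'.cmts S := by
  by_contra hne
  exact h (.hashCmts (T.cmts S) (T'.cmts S)) (by simp [readOff])
    ⟨hne, by rw [hT.1, hT'.1, h0]⟩

theorem state_eq (h : NoOutput F S I T T') (hT : T.Accepts S I (Fintype.card F))
    (hT' : T'.Accepts S I (Fintype.card F)) (h0 : T.h0 = T'.h0) {j : Leaf D} (hj : j ≠ T.ch2)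
    (hj' : j ≠ T'.ch2) : T.state S ⟨j, hj⟩ = T'.state S ⟨j, hj'⟩ := by
  by_contra hne
  refine h (.com _ _ (T.rnd S ⟨j, hj⟩) (T'.rnd S ⟨j, hj'⟩)) ?_ ⟨hne, ?_⟩
  · simp only [readOff, List.mem_append, List.mem_map, Finset.mem_toList]
    exact .inl <| .inl <| .inl <| .inl ⟨⟨j, hj, hj'⟩, Finset.mem_univ _, rfl⟩
  · simpa only [Transcript.cmts, dif_pos hj, dif_pos hj'] using congrFun (h.cmts_eq hT hT' h0) j

theorem share_eq (h : NoOutput F S I T T') (hT : T.Accepts S I (Fintype.card F))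
    (hT' : T'.Accepts S I (Fintype.card F)) (h0 : T.h0 = T'.h0) {j : Leaf D} (hj : j ≠ T.ch2)
    (hj' : j ≠ T'.ch2) : T.share S ⟨j, hj⟩ = T'.share S ⟨j, hj'⟩ := by
  rw [Transcript.share, Transcript.share, h.state_eq hT hT' h0 hj hj']

theorem execHashes_eq (h : NoOutput F S I T T') (hT : T.Accepts S I (Fintype.card F))
    (hT' : T'.Accepts S I (Fintype.card F)) (h1 : T.h1 = T'.h1) :
    T.execHashes S I (Fintype.card F) = T'.execHashes S I (Fintype.card F) := by
  by_contra hne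
  exact h (.hashAll _ _) (by simp [readOff]) ⟨hne, by rw [hT.2.2.2, hT'.2.2.2, h1]⟩

theorem exec_eq (h : NoOutput F S I T T') (hT : T.Accepts S I (Fintype.card F))
    (hT' : T'.Accepts S I (Fintype.card F)) (h1 : T.h1 = T'.h1) (d : Fin D) :
    T.exec S I (Fintype.card F) d = T'.exec S I (Fintype.card F) d := by
  by_contra hne
  refine h (.hashExec _ _) ?_ ⟨hne, congrFun (h.execHashes_eq hT hT' h1) d⟩
  simp only [readOff, List.mem_append, List.mem_map, Finset.mem_toList]
  exact .inl <| .inl <| .inr ⟨d, Finset.mem_univ _, rfl⟩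

theorem not_isWitness (h : NoOutput F S I T₁ T₂) (hne : T₁.ch2 ≠ T₂.ch2) :
    ¬ I.IsWitness F r (fullVec I True (Share.sum Finset.univ (jointShare S T₁ T₂ hne)).xB) := by
  rw [jointShare_sum_xB]
  refine h (.witness _) ?_
  simp only [readOff, dif_pos hne, List.mem_append, List.mem_singleton]
  exact .inr trivial

theorem share_eq_jointShare (hne : T₁.ch2 ≠ T₂.ch2) (h₁ : NoOutput F S I T₁ T)
    (h₂ : NoOutput F S I T₂ T) (hT₁ : T₁.Accepts S I (Fintype.card F))
    (hT₂ : T₂.Accepts S I (Fintype.card F)) (hT : T.Accepts S I (Fintype.card F))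
    (h0₁ : T₁.h0 = T.h0) (h0₂ : T₂.h0 = T.h0) (j : {j : Leaf D // j ≠ T.ch2}) :
    T.share S j = jointShare S T₁ T₂ hne j.1 := by
  unfold jointShare
  split_ifs with hj
  · exact (h₁.share_eq hT₁ hT h0₁ hj j.2).symm
  · exact (h₂.share_eq hT₂ hT h0₂ _ j.2).symm

/-- In a dimension where the hidden leaves differ, each main party is fully opened in one of the
two transcripts, so both its shares of `α` and of `v` are the honest ones. -/
theorem vValue_eq_zero (h : NoOutput F S I T T') (hT : T.Accepts S I (Fintype.card F))
    (hT' : T'.Accepts S I (Fintype.card F)) (hch : T.ch1 = T'.ch1) (h1 : T.h1 = T'.h1)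
    (hne : T.ch2 ≠ T'.ch2) {s : Leaf D → Share K L k r} (hs : ∀ j, T.share S j = s j.1)
    (hs' : ∀ j, T'.share S j = s j.1) :
    vValue (Fintype.card F) I (Share.sum Finset.univ s) T.ch1 = 0 := by
  obtain ⟨d, hd⟩ := Function.ne_iff.1 hne
  set b := T.ch2 d
  have hb : T.ch2 d ≠ !b := by simp [b]
  have hb' : T'.ch2 d ≠ b := hd.symm
  have hexec := h.exec_eq hT hT' h1 d
  have hmainα : T.mainAlpha S I (Fintype.card F) d = T'.mainAlpha S I (Fintype.card F) d :=
    congrArg Prod.fst hexec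
  have hmainv : T.mainV S I (Fintype.card F) d = T'.mainV S I (Fintype.card F) d :=
    congrArg Prod.snd hexec
  have hα : T.alpha S I (Fintype.card F) d
      = alphaShare (Fintype.card F) I T.ch1 True (Share.sum Finset.univ s) := by
    rw [Transcript.alpha, sum_bool_eq_add_not _ b, congrFun hmainα b, Transcript.mainAlpha,
      Transcript.mainAlpha, if_neg hb, if_neg hb', Transcript.mainShare_eq_sum hs hb,
      Transcript.mainShare_eq_sum hs' hb', ← hch, alphaShare_add,
      Share.sum_filter_add_sum_filter_not]
  have hα' : T'.alpha S I (Fintype.card F) d = T.alpha S I (Fintype.card F) d := by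
    rw [Transcript.alpha, Transcript.alpha, hmainα]
  calc vValue (Fintype.card F) I (Share.sum Finset.univ s) T.ch1
      = ∑ b', T.mainV S I (Fintype.card F) d b' := by
        rw [sum_bool_eq_add_not _ b, congrFun hmainv b, Transcript.mainV, Transcript.mainV,
          if_neg hb, if_neg hb', Transcript.mainShare_eq_sum hs hb,
          Transcript.mainShare_eq_sum hs' hb', ← hch, hα', vShare_add,
          Share.sum_filter_add_sum_filter_not, hα, vValue]
    _ = 0 := hT.2.1 d

end NoOutput

end Consistency

section Confinement

variable (F : Type*) {K L : Type*} [Fintype F] [Field K] [Field L] [Algebra K L] {n k r D : ℕ}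
  {Seed Salt Rnd Cmt Dig Tape : Type*}
  (S : Primitives K L k r D Seed Salt Rnd Cmt Dig) (I : Instance K n k)
  (P : Prover K L n k r D Seed Salt Cmt Dig Tape)

/-- The verifier accepts the execution with tape `t` and challenges `c`, `i`. -/
def Prover.Accepts (t : Tape) (c : Ch1 L n k) (i : Leaf D) : Prop :=
  (P.transcript t c i).Accepts S I (Fintype.card F)

/-- The execution with tape `t` and challenges `c`, `i` is accepted and its transcript has been
obtained in the calls of `h`. -/
def ObservedAccept (h : List (Query L n k D × Tape)) (t : Tape) (c : Ch1 L n k) (i : Leaf D) :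
    Prop :=
  P.Accepts F S I t c i ∧ P.transcript t c i ∈ Extractor.transcripts P h

variable {F S I P} {h h' : List (Query L n k D × Tape)} {t : Tape}

theorem ObservedAccept.mono {c : Ch1 L n k} {i : Leaf D} (hobs : ObservedAccept F S I P h t c i)
    (hh : h ⊆ h') : ObservedAccept F S I P h' t c i :=
  ⟨hobs.1, List.map_subset _ hh hobs.2⟩

variable [Field F] [Algebra F K] [Module.Finite F K]

variable (F S I P h t) in
/-- After the calls of `h`, as long as the extractor has no output, two accepted executions with
tape `t` and the same first challenge `c` can be observed only if `c ∈ G`. -/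
def Confines (G : Finset (Ch1 L n k)) : Prop :=
  ∀ h', h ⊆ h' → Extractor.output F S I P h' = none → ∀ c i j, i ≠ j →
    ObservedAccept F S I P h' t c i → ObservedAccept F S I P h' t c j → c ∈ G

theorem Confines.mono {G : Finset (Ch1 L n k)} (hG : Confines F S I P h t G) (hh : h ⊆ h') :
    Confines F S I P h' t G :=
  fun _ hh' => hG _ (List.Subset.trans hh hh')

theorem exists_confines [Fintype L] (hr : 1 ≤ r) (ho : Extractor.output F S I P h = none)
    {c₁ c₂ : Ch1 L n k} {i₁ i₂ : Leaf D} (hne : i₁ ≠ i₂)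
    (hobs₁ : ObservedAccept F S I P h t c₁ i₁) (hobs₂ : ObservedAccept F S I P h t c₂ i₂) :
    ∃ G : Finset (Ch1 L n k),
      (G.dens : ℝ) ≤ 2 / Fintype.card L - 1 / (Fintype.card L : ℝ) ^ 2 ∧
      Confines F S I P h t G := by
  classical
  have hno {h'} (ho' : Extractor.output F S I P h' = none) {c c' : Ch1 L n k} {i i' : Leaf D}
      (hobs : ObservedAccept F S I P h' t c i) (hobs' : ObservedAccept F S I P h' t c' i') :
      NoOutput F S I (P.transcript t c i) (P.transcript t c' i') :=
    fun _ hm => Extractor.not_valid_of_output_eq_none ho' hobs.2 hobs'.2 hm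
  have hch2 : (P.transcript t c₁ i₁).ch2 ≠ (P.transcript t c₂ i₂).ch2 := hne
  set s := jointShare S (P.transcript t c₁ i₁) (P.transcript t c₂ i₂) hch2
  refine ⟨Finset.univ.filter fun c => vValue (Fintype.card F) I (Share.sum .univ s) c = 0, ?_, ?_⟩
  · rw [← rate_mem]
    simpa only [Finset.mem_filter_univ] using
      rate_vValue_eq_zero_le F hr I _ ((hno ho hobs₁ hobs₂).not_isWitness hch2)
  · intro h' hh ho' c i j hij hobsi hobsj
    have hshare {i'} (hobs : ObservedAccept F S I P h' t c i') :=
      NoOutput.share_eq_jointShare hch2 (hno ho' (hobs₁.mono hh) hobs)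
        (hno ho' (hobs₂.mono hh) hobs) hobs₁.1 hobs₂.1 hobs.1 rfl rfl
    exact (Finset.mem_filter_univ _).2 <| (hno ho' hobsi hobsj).vValue_eq_zero hobsi.1 hobsj.1
      rfl rfl hij (hshare hobsi) (hshare hobsj)

end Confinement

/-! ### The extractor -/

/-- Situation of the extractor: it starts a new session, or it has found a pair of accepted
executions with the same first challenge in the session `s`, or it repeats the first challenge `c`,
accepted with the hidden leaf `i`, at most `f + 1` times. In the last case, `second` tells whether
a pair has already been found in the session. -/
inductive Mode (L : Type*) (n k D : ℕ)
  | start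
  | pair (s : ℕ)
  | rep (second : Bool) (s : ℕ) (c : Ch1 L n k) (i : Leaf D) (f : ℕ)

namespace Mode

variable {L : Type*} {n k D : ℕ}

/-- The situation in which the first challenge `c` is to be repeated at most `f` times. -/
def retry (second : Bool) (s : ℕ) (c : Ch1 L n k) (i : Leaf D) : ℕ → Mode L n k D
  | 0 => if second then .pair s else .start
  | f + 1 => .rep second s c i f

/-- Situation after a further call, with at most `B` repetitions of a first challenge. -/
def update (B : ℕ) : Mode L n k D → Query L n k D × Bool → Mode L n k D
  | .start, x => if x.2 then retry false x.1.session x.1.ch1 x.1.ch2 B else .start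
  | .pair s, x => if x.2 then retry true s x.1.ch1 x.1.ch2 B else .pair s
  | .rep second s c i f, x =>
    if x.2 = true ∧ x.1.ch2 ≠ i then (if second then .start else .pair s)
    else retry second s c i f

/-- Situation after a list of calls, latest first. -/
def ofHistory (B : ℕ) (h : List (Query L n k D × Bool)) : Mode L n k D :=
  h.foldr (fun x m => m.update B x) .start

end Mode

/-- In a new session, the extractor tries uniform challenges, and if they are accepted it repeats
the first one with uniform hidden leaves, at most `B` times, until it finds a pair of accepted
executions with distinct hidden leaves. Having failed, it starts a new session; having found a pair,
it proceeds in the same way within the session until it finds a second pair. -/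
def pairExtractor (L : Type*) [Field L] [Fintype L] (n k D B : ℕ) : Extractor L n k D where
  next h :=
    match Mode.ofHistory B h with
    | .start => (PMF.uniformOfFintype (Ch1 L n k × Leaf D)).map fun x =>
        ⟨(h.map fun c => c.1.session).sum + 1, x.1, x.2⟩
    | .pair s => (PMF.uniformOfFintype (Ch1 L n k × Leaf D)).map fun x => ⟨s, x.1, x.2⟩
    | .rep _ s c _ _ => (PMF.uniformOfFintype (Leaf D)).map fun j => ⟨s, c, j⟩

section Sessions

variable {L : Type*} {n k r D : ℕ} {K Seed Salt Cmt Dig Tape : Type*}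

/-- The latest call of `h` belongs to the session `s` and uses the tape `t`. -/
def InSession (h : List (Query L n k D × Tape)) (s : ℕ) (t : Tape) : Prop :=
  ∃ q l, h = (q, t) :: l ∧ q.session = s

theorem inSession_cons (s : ℕ) (c : Ch1 L n k) (i : Leaf D) (t : Tape)
    (h : List (Query L n k D × Tape)) : InSession ((⟨s, c, i⟩, t) :: h) s t :=
  ⟨_, h, rfl, rfl⟩

/-- Distribution of the tape of a call in the session `s` after the calls of `h`. -/
def sessionTape (P : Prover K L n k r D Seed Salt Cmt Dig Tape) (h : List (Query L n k D × Tape))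
    (s : ℕ) : PMF Tape :=
  (h.find? fun c => decide (c.1.session = s)).elim P.tape fun c => PMF.pure c.2

variable {P : Prover K L n k r D Seed Salt Cmt Dig Tape} {h : List (Query L n k D × Tape)} {s : ℕ}

theorem sessionTape_of_inSession {t : Tape} (hs : InSession h s t) :
    sessionTape P h s = PMF.pure t := by
  obtain ⟨q, l, rfl, hq⟩ := hs
  rw [sessionTape, List.find?_cons_of_pos (by simpa using hq), Option.elim_some]

theorem sessionTape_of_forall_ne (hs : ∀ c ∈ h, c.1.session ≠ s) : sessionTape P h s = P.tape := by
  rw [sessionTape, List.find?_eq_none.2 (by simpa using hs), Option.elim_none]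

end Sessions

section Potential

variable (F : Type*) {K L : Type*} [Fintype F] [Field K] [Field L] [Algebra K L] {n k r D : ℕ}
  {Seed Salt Rnd Cmt Dig Tape : Type*}
  (S : Primitives K L k r D Seed Salt Rnd Cmt Dig) (I : Instance K n k)
  (P : Prover K L n k r D Seed Salt Cmt Dig Tape) (B : ℕ) (ε Δ V : ℝ)

open Classical in
/-- What the extractor sees of a list of calls. -/
def view (h : List (Query L n k D × Tape)) : List (Query L n k D × Bool) :=
  h.map fun c => (c.1, decide (P.Accepts F S I c.2 c.1.ch1 c.1.ch2))

/-- Situation of the extractor after the calls of `h`. -/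
def modeAfter (h : List (Query L n k D × Tape)) : Mode L n k D :=
  Mode.ofHistory B (view F S I P h)

open Classical in
theorem modeAfter_cons (h : List (Query L n k D × Tape)) (q : Query L n k D) (t : Tape) :
    modeAfter F S I P B ((q, t) :: h)
      = (modeAfter F S I P B h).update B (q, decide (P.Accepts F S I t q.ch1 q.ch2)) :=
  rfl

variable {F S I P B} in
theorem session_ne_of_mem {h : List (Query L n k D × Tape)} {x : Query L n k D × Tape}
    (hx : x ∈ h) : x.1.session ≠ ((view F S I P h).map fun y => y.1.session).sum + 1 := by
  have hle : x.1.session ≤ ((view F S I P h).map fun y => y.1.session).sum :=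
    List.le_sum_of_mem (by simpa [view] using ⟨x.1, ⟨_, hx⟩, rfl⟩)
  omega

section Rep

variable {F S I P B} {h : List (Query L n k D × Tape)} {second : Bool} {s : ℕ} {c : Ch1 L n k}
  {i j : Leaf D} {f : ℕ} {t : Tape}

theorem modeAfter_cons_of_rep_of_accepts (hm : modeAfter F S I P B h = .rep second s c i f)
    (hj : j ≠ i) (hacc : P.Accepts F S I t c j) :
    modeAfter F S I P B ((⟨s, c, j⟩, t) :: h) = if second then .start else .pair s := by
  rw [modeAfter_cons, hm]
  simp [Mode.update, hacc, hj]

theorem modeAfter_cons_of_rep_of_not (hm : modeAfter F S I P B h = .rep second s c i f)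
    (hj : ¬ (P.Accepts F S I t c j ∧ j ≠ i)) :
    modeAfter F S I P B ((⟨s, c, j⟩, t) :: h) = .retry second s c i f := by
  rw [modeAfter_cons, hm]
  exact if_neg (by simpa using hj)

end Rep

variable [Field F] [Algebra F K] [Module.Finite F K] [Fintype L]
  (h : List (Query L n k D × Tape))

/-- A pair of accepted executions has been found on the tape `t`, after which first challenges that
yield another one belong to `G`, and `G` is small. -/
structure PairFound (t : Tape) (G : Finset (Ch1 L n k)) : Prop where
  pairProb_ne_zero : pairProb (P.Accepts F S I t) B ≠ 0
  cheatingRate_le : cheatingRate (Leaf D) G ≤ ε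
  confines : Confines F S I P h t G

open Classical in
/-- A bound for the expected number of further calls after the calls of `h`, according to the
situation of the extractor. -/
inductive Budget : ℝ → Prop
  | halted (ho : (Extractor.output F S I P h).isSome) : Budget 0
  | start (hm : modeAfter F S I P B h = .start) : Budget V
  | pair {s : ℕ} {t : Tape} {G : Finset (Ch1 L n k)} (hm : modeAfter F S I P B h = .pair s)
      (hs : InSession h s t) (hG : PairFound F S I P B ε h t G) :
      Budget (pairPotential (P.Accepts F S I t) B ε Δ V)
  | firstRep {s : ℕ} {t : Tape} {c : Ch1 L n k} {i : Leaf D} {f : ℕ}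
      (hm : modeAfter F S I P B h = .rep false s c i f) (hs : InSession h s t)
      (hobs : ObservedAccept F S I P h t c i) :
      Budget (trialCost (otherRate (P.Accepts F S I t c))
        (pairPotential (P.Accepts F S I t) B ε Δ V) V (f + 1))
  | secondRep {s : ℕ} {t : Tape} {G : Finset (Ch1 L n k)} {c : Ch1 L n k} {i : Leaf D} {f : ℕ}
      (hm : modeAfter F S I P B h = .rep true s c i f) (hs : InSession h s t)
      (hobs : ObservedAccept F S I P h t c i) (hG : PairFound F S I P B ε h t G) :
      Budget (trialCost (otherRate (P.Accepts F S I t c)) (if c ∈ G then V else 0)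
        (pairPotential (P.Accepts F S I t) B ε Δ V) (f + 1))

/-- The least budget of a history. -/
def potential : ℝ≥0∞ :=
  ⨅ v : ℝ, ⨅ _ : Budget F S I P B ε Δ V h v, ENNReal.ofReal v

variable {F S I P B ε Δ V h}

theorem potential_le {v : ℝ} (hv : Budget F S I P B ε Δ V h v) :
    potential F S I P B ε Δ V h ≤ ENNReal.ofReal v :=
  iInf₂_le v hv

theorem potential_le_of_output_eq_none_imp {v : ℝ}
    (hv : Extractor.output F S I P h = none → Budget F S I P B ε Δ V h v) :
    potential F S I P B ε Δ V h ≤ ENNReal.ofReal v := by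
  cases ho : Extractor.output F S I P h with
  | none => exact potential_le (hv ho)
  | some o => exact (potential_le (.halted (by simp [ho]))).trans (by simp)

variable {s : ℕ} {t : Tape} {G : Finset (Ch1 L n k)} {c : Ch1 L n k} {i : Leaf D} {f : ℕ}

theorem PairFound.cons (hG : PairFound F S I P B ε h t G) (x : Query L n k D × Tape) :
    PairFound F S I P B ε (x :: h) t G :=
  ⟨hG.1, hG.2, hG.3.mono (List.subset_cons_self _ _)⟩

theorem Budget.of_retry_false (hm : modeAfter F S I P B h = .retry false s c i f)
    (hs : InSession h s t) (hobs : ObservedAccept F S I P h t c i) :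
    Budget F S I P B ε Δ V h (trialCost (otherRate (P.Accepts F S I t c))
      (pairPotential (P.Accepts F S I t) B ε Δ V) V f) := by
  cases f with
  | zero => exact .start hm
  | succ f => exact .firstRep hm hs hobs

open Classical in
theorem Budget.of_retry_true (hm : modeAfter F S I P B h = .retry true s c i f)
    (hs : InSession h s t) (hobs : ObservedAccept F S I P h t c i)
    (hG : PairFound F S I P B ε h t G) :
    Budget F S I P B ε Δ V h (trialCost (otherRate (P.Accepts F S I t c))
      (if c ∈ G then V else 0) (pairPotential (P.Accepts F S I t) B ε Δ V) f) := by
  cases f with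
  | zero => exact .pair hm hs hG
  | succ f => exact .secondRep hm hs hobs hG

end Potential

/-! ### The potential decreases -/

section AcceptProb

variable {F K L : Type*} [Fintype F] [Field K] [Field L] [Fintype L] [Algebra K L] {n k r D : ℕ}
  {Seed Salt Rnd Cmt Dig Tape : Type*} (S : Primitives K L k r D Seed Salt Rnd Cmt Dig)
  (I : Instance K n k) (P : Prover K L n k r D Seed Salt Cmt Dig Tape)

theorem acceptProb_nonneg (q : ℕ) : 0 ≤ P.acceptProb S I q :=
  ENNReal.toReal_nonneg

theorem expectation_meanRate :
    expectation P.tape (fun t => ENNReal.ofReal (meanRate (P.Accepts F S I t)))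
      = ENNReal.ofReal (P.acceptProb S I (Fintype.card F)) := by
  classical
  have hrate (t : Tape) (c : Ch1 L n k) :
      expectation (PMF.uniformOfFintype (Leaf D))
        (fun i => if P.transcript t c i ∈ {T | T.Accepts S I (Fintype.card F)} then 1 else 0)
      = ENNReal.ofReal (rate (P.Accepts F S I t c)) := by
    rw [rate_eq_expect, ← expectation_uniformOfFintype_ofReal fun i => by split_ifs <;> norm_num]
    congr! 2 with i
    by_cases hi : P.Accepts F S I t c i
    · rw [if_pos hi, ENNReal.ofReal_one]
      exact if_pos hi
    · rw [if_neg hi, ENNReal.ofReal_zero]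
      exact if_neg hi
  rw [Prover.acceptProb, ENNReal.ofReal_toReal (ne_top_of_le_ne_top ENNReal.one_ne_top ?_),
    toOuterMeasure_eq_expectation]
  · simp only [expectation_bind, expectation_map, hrate,
      expectation_uniformOfFintype_ofReal fun _ => rate_nonneg, meanRate]
  · rw [toOuterMeasure_eq_expectation]
    refine (expectation_mono _ fun T => ?_).trans_eq (expectation_const _ 1)
    split_ifs <;> simp

theorem acceptProb_le_one : P.acceptProb S I (Fintype.card F) ≤ 1 := by
  rw [← ENNReal.ofReal_le_one, ← expectation_meanRate]
  exact (expectation_mono _ fun _ => ENNReal.ofReal_le_one.2 meanRate_le_one).trans_eq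
    (expectation_const _ 1)

variable {S I P} in
theorem expectation_attemptValue_le {B : ℕ} {ε Δ V : ℝ} (hΔ : 0 ≤ Δ)
    (hε : 1 / Fintype.card (Leaf D) ≤ ε) (hV : 0 ≤ V) :
    expectation P.tape (fun t => ENNReal.ofReal (attemptValue (P.Accepts F S I t) B
        (fun _ => pairPotential (P.Accepts F S I t) B ε Δ V) V))
      ≤ ENNReal.ofReal (V + 2 * (1 + B * P.acceptProb S I (Fintype.card F))
        - V * (tangentSlope (B * Δ) * (P.acceptProb S I (Fintype.card F) - ε)
          - tangentOffset (B * Δ) Δ)) := by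
  have hσ : 0 ≤ tangentSlope (B * Δ) := tangentSlope_nonneg (by positivity)
  have hτ : 0 ≤ tangentOffset (B * Δ) Δ := tangentOffset_nonneg (by positivity) hΔ
  have hε₀ : 0 ≤ ε := le_trans (by positivity) hε
  have key := expectation_ofReal_le_of_affine P.tape (ρ := fun t => meanRate (P.Accepts F S I t))
    (f := fun t => attemptValue (P.Accepts F S I t) B
      (fun _ => pairPotential (P.Accepts F S I t) B ε Δ V) V)
    (a := V * tangentSlope (B * Δ))
    (b := V + 2 + V * tangentSlope (B * Δ) * ε + V * tangentOffset (B * Δ) Δ) (c := 2 * B)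
    (fun t => attemptValue_nonneg (fun _ => pairPotential_nonneg hΔ hε hV B) hV)
    (fun t => meanRate_nonneg) (by positivity) (by positivity) (by positivity)
    (acceptProb_nonneg S I P _) (expectation_meanRate S I P) fun t => ?_
  · refine key.trans_eq (congrArg ENNReal.ofReal ?_)
    ring
  · have hcost := attemptCost_le (acc := P.Accepts F S I t) B
    have hescape := mul_le_mul_of_nonneg_right (le_max_right 0 (tangentSlope (B * Δ)
      * (meanRate (P.Accepts F S I t) - ε) - tangentOffset (B * Δ) Δ)) hV
    have hvalue := attemptValue_start_le (acc := P.Accepts F S I t) hΔ hε V B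
    rw [escapeProb] at hvalue
    linarith

end AcceptProb

section SoundnessError

theorem card_leaf (D : ℕ) : Fintype.card (Leaf D) = 2 ^ D := by simp

theorem falsePositiveRate_nonneg (q m η : ℕ) : 0 ≤ falsePositiveRate q m η := by
  have hle : (((q ^ (m * η) : ℕ) : ℝ))⁻¹ ≤ 1 := Nat.cast_inv_le_one _
  have hnonneg : 0 ≤ (((q ^ (m * η) : ℕ) : ℝ))⁻¹ := by positivity
  have hfactor : falsePositiveRate q m η
      = ((q ^ (m * η) : ℕ) : ℝ)⁻¹ * (2 - ((q ^ (m * η) : ℕ) : ℝ)⁻¹) := by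
    rw [falsePositiveRate, mul_assoc 2, mul_comm 2, pow_mul _ _ 2, Nat.cast_pow]
    ring
  rw [hfactor]
  exact mul_nonneg hnonneg (by linarith)

theorem one_div_card_le_soundnessError (q m η D : ℕ) :
    1 / Fintype.card (Leaf D) ≤ soundnessError q m η D := by
  have hD : (1 : ℝ) / 2 ^ D ≤ 1 := div_le_one_of_le₀ (one_le_pow₀ one_le_two) (by positivity)
  rw [soundnessError, card_leaf, Nat.cast_pow, Nat.cast_ofNat]
  linarith [mul_nonneg (falsePositiveRate_nonneg q m η) (sub_nonneg.2 hD)]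

variable {F K L : Type*} [Field F] [Fintype F] [Field K] [Algebra F K] [Module.Finite F K]
  [Field L] [Fintype L] [Algebra K L]

theorem falsePositiveRate_eq :
    falsePositiveRate (Fintype.card F) (Module.finrank F K) (Module.finrank K L)
      = 2 / Fintype.card L - 1 / (Fintype.card L : ℝ) ^ 2 := by
  have : Finite K := Module.finite_of_finite F
  have hcard : Fintype.card L
      = Fintype.card F ^ (Module.finrank F K * Module.finrank K L) := by
    rw [← Nat.card_eq_fintype_card, Module.natCard_eq_pow_finrank (K := K),
      Module.natCard_eq_pow_finrank (K := F) (V := K), Nat.card_eq_fintype_card, pow_mul]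
  rw [falsePositiveRate, hcard, Nat.cast_pow, ← pow_mul, mul_assoc 2, mul_comm 2]

theorem cheatingRate_le_soundnessError {C : Type*} [Fintype C] {G : Finset C} {D : ℕ}
    (hG : (G.dens : ℝ) ≤ 2 / Fintype.card L - 1 / (Fintype.card L : ℝ) ^ 2) :
    cheatingRate (Leaf D) G
      ≤ soundnessError (Fintype.card F) (Module.finrank F K) (Module.finrank K L) D := by
  rw [← falsePositiveRate_eq (F := F) (K := K)] at hG
  have hD : (1 : ℝ) / 2 ^ D ≤ 1 := div_le_one_of_le₀ (one_le_pow₀ one_le_two) (by positivity)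
  rw [cheatingRate, soundnessError, card_leaf, Nat.cast_pow, Nat.cast_ofNat]
  linarith [mul_le_mul_of_nonneg_right hG (sub_nonneg.2 hD)]

end SoundnessError

section Steps

variable {F K L : Type*} [Field F] [Fintype F] [Field K] [Algebra F K] [Module.Finite F K]
  [Field L] [Algebra K L] {n k r D : ℕ} {Seed Salt Rnd Cmt Dig Tape : Type*}
  {S : Primitives K L k r D Seed Salt Rnd Cmt Dig} {I : Instance K n k}
  {P : Prover K L n k r D Seed Salt Cmt Dig Tape} {h : List (Query L n k D × Tape)}

theorem expectation_step {E : Extractor L n k D} (ho : Extractor.output F S I P h = none)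
    {α : Type*} {μ : PMF α} {g : α → Query L n k D} (hnext : E.next (view F S I P h) = μ.map g)
    (Φ : List (Query L n k D × Tape) → ℝ≥0∞) :
    expectation (E.step F S I P h) Φ
      = expectation μ fun a => expectation (sessionTape P h (g a).session)
        fun t => Φ ((g a, t) :: h) := by
  have hstep : E.step F S I P h = (E.next (view F S I P h)).bind fun qry =>
      (sessionTape P h qry.session).map fun t => (qry, t) :: h := by
    rw [Extractor.step, ho, if_neg (by simp)]
    congr 1
    funext qry
    rw [sessionTape]
    cases h.find? fun c => decide (c.1.session = qry.session) <;> rfl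
  rw [hstep, hnext, expectation_bind, expectation_map]
  simp only [expectation_map]

theorem expectation_step_of_inSession {E : Extractor L n k D}
    (ho : Extractor.output F S I P h = none) {s : ℕ} {t : Tape} (hs : InSession h s t)
    {α : Type*} {μ : PMF α} {g : α → Query L n k D} (hnext : E.next (view F S I P h) = μ.map g)
    (hg : ∀ a, (g a).session = s) (Φ : List (Query L n k D × Tape) → ℝ≥0∞) :
    expectation (E.step F S I P h) Φ = expectation μ fun a => Φ ((g a, t) :: h) := by
  simp only [expectation_step ho hnext, hg, sessionTape_of_inSession hs, expectation_pure]

theorem expectation_step_of_forall_ne {E : Extractor L n k D}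
    (ho : Extractor.output F S I P h = none) {s : ℕ} (hs : ∀ c ∈ h, c.1.session ≠ s)
    {α : Type*} {μ : PMF α} {g : α → Query L n k D} (hnext : E.next (view F S I P h) = μ.map g)
    (hg : ∀ a, (g a).session = s) (Φ : List (Query L n k D × Tape) → ℝ≥0∞) :
    expectation (E.step F S I P h) Φ
      = expectation P.tape fun t => expectation μ fun a => Φ ((g a, t) :: h) := by
  simp only [expectation_step ho hnext, hg, sessionTape_of_forall_ne hs]
  exact expectation_comm _ _ _

variable [Fintype L] {B : ℕ} {ε Δ V : ℝ} {s : ℕ} {t : Tape}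

open Classical in
theorem potential_cons_le_of_start (hm : modeAfter F S I P B h = .start) (c : Ch1 L n k)
    (i : Leaf D) :
    potential F S I P B ε Δ V ((⟨s, c, i⟩, t) :: h) ≤ ENNReal.ofReal
      (if P.Accepts F S I t c i then trialCost (otherRate (P.Accepts F S I t c))
        (pairPotential (P.Accepts F S I t) B ε Δ V) V B else V) := by
  have hmode := modeAfter_cons F S I P B h ⟨s, c, i⟩ t
  simp only [hm, Mode.update, decide_eq_true_eq] at hmode
  split_ifs at hmode ⊢ with hacc
  · exact potential_le (.of_retry_false hmode (inSession_cons ..) ⟨hacc, List.mem_cons_self⟩)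
  · exact potential_le (.start hmode)

open Classical in
theorem potential_cons_le_of_pair {G : Finset (Ch1 L n k)}
    (hm : modeAfter F S I P B h = .pair s) (hG : PairFound F S I P B ε h t G) (c : Ch1 L n k)
    (i : Leaf D) :
    potential F S I P B ε Δ V ((⟨s, c, i⟩, t) :: h) ≤ ENNReal.ofReal
      (if P.Accepts F S I t c i then trialCost (otherRate (P.Accepts F S I t c))
        (if c ∈ G then V else 0) (pairPotential (P.Accepts F S I t) B ε Δ V) B
      else pairPotential (P.Accepts F S I t) B ε Δ V) := by
  have hmode := modeAfter_cons F S I P B h ⟨s, c, i⟩ t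
  simp only [hm, Mode.update, decide_eq_true_eq] at hmode
  by_cases hacc : P.Accepts F S I t c i
  · rw [if_pos hacc] at hmode ⊢
    exact potential_le
      (.of_retry_true hmode (inSession_cons ..) ⟨hacc, List.mem_cons_self⟩ (hG.cons _))
  · rw [if_neg hacc] at hmode ⊢
    exact potential_le (.pair hmode (inSession_cons ..) (hG.cons _))

theorem step_start_le (hΔ : 0 ≤ Δ) (hε : 1 / Fintype.card (Leaf D) ≤ ε) (hV : 0 ≤ V)
    (hstart : 2 * (1 + B * P.acceptProb S I (Fintype.card F))
      ≤ V * (tangentSlope (B * Δ) * (P.acceptProb S I (Fintype.card F) - ε)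
        - tangentOffset (B * Δ) Δ))
    (ho : Extractor.output F S I P h = none) (hm : modeAfter F S I P B h = .start) :
    1 + expectation ((pairExtractor L n k D B).step F S I P h) (potential F S I P B ε Δ V)
      ≤ ENNReal.ofReal V := by
  have hnext : (pairExtractor L n k D B).next (view F S I P h)
      = (PMF.uniformOfFintype (Ch1 L n k × Leaf D)).map fun x =>
        ⟨((view F S I P h).map fun y => y.1.session).sum + 1, x.1, x.2⟩ := by
    rw [modeAfter] at hm
    simp only [pairExtractor, hm]
  rw [expectation_step_of_forall_ne ho (fun _ => session_ne_of_mem) hnext fun _ => rfl,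
    ← expectation_const P.tape 1, ← expectation_add]
  calc _ ≤ expectation P.tape (fun t => ENNReal.ofReal (attemptValue (P.Accepts F S I t) B
        (fun _ => pairPotential (P.Accepts F S I t) B ε Δ V) V)) :=
        expectation_mono _ fun t => by
          rw [← one_add_expectation_attempt B (fun _ => pairPotential_nonneg hΔ hε hV B) hV]
          gcongr
          exact expectation_mono _ fun x => potential_cons_le_of_start hm x.1 x.2
    _ ≤ _ := expectation_attemptValue_le hΔ hε hV
    _ ≤ ENNReal.ofReal V := ENNReal.ofReal_le_ofReal (by linarith)

theorem step_pair_le (hΔ : 0 ≤ Δ) (hε : 1 / Fintype.card (Leaf D) ≤ ε) (hV : 0 ≤ V)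
    (ho : Extractor.output F S I P h = none) (hm : modeAfter F S I P B h = .pair s)
    (hs : InSession h s t) {G : Finset (Ch1 L n k)} (hG : PairFound F S I P B ε h t G) :
    1 + expectation ((pairExtractor L n k D B).step F S I P h) (potential F S I P B ε Δ V)
      ≤ ENNReal.ofReal (pairPotential (P.Accepts F S I t) B ε Δ V) := by
  classical
  have hnext : (pairExtractor L n k D B).next (view F S I P h)
      = (PMF.uniformOfFintype (Ch1 L n k × Leaf D)).map fun x => ⟨s, x.1, x.2⟩ := by
    rw [modeAfter] at hm
    simp only [pairExtractor, hm]
  have hout (c : Ch1 L n k) : 0 ≤ if c ∈ G then V else 0 := by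
    split_ifs
    exacts [hV, le_rfl]
  rw [expectation_step_of_inSession ho hs hnext fun _ => rfl]
  calc _ ≤ ENNReal.ofReal (attemptValue (P.Accepts F S I t) B (fun c => if c ∈ G then V else 0)
        (pairPotential (P.Accepts F S I t) B ε Δ V)) := by
        rw [← one_add_expectation_attempt B hout (pairPotential_nonneg hΔ hε hV B)]
        gcongr
        exact expectation_mono _ fun x => potential_cons_le_of_pair hm hG x.1 x.2
    _ ≤ _ := ENNReal.ofReal_le_ofReal
        (attemptValue_pairPotential_le hΔ hV hG.cheatingRate_le hG.pairProb_ne_zero)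

variable {c : Ch1 L n k} {i : Leaf D} {f : ℕ} {G : Finset (Ch1 L n k)}

theorem step_rep_le (ho : Extractor.output F S I P h = none) {second : Bool}
    (hm : modeAfter F S I P B h = .rep second s c i f) (hs : InSession h s t)
    (hacc : P.Accepts F S I t c i) {out fail : ℝ} (hout : 0 ≤ out) (hfail : 0 ≤ fail)
    (hsucc : ∀ j, j ≠ i → P.Accepts F S I t c j →
      potential F S I P B ε Δ V ((⟨s, c, j⟩, t) :: h) ≤ ENNReal.ofReal out)
    (hretry : ∀ j, modeAfter F S I P B ((⟨s, c, j⟩, t) :: h) = .retry second s c i f →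
      potential F S I P B ε Δ V ((⟨s, c, j⟩, t) :: h)
        ≤ ENNReal.ofReal (trialCost (otherRate (P.Accepts F S I t c)) out fail f)) :
    1 + expectation ((pairExtractor L n k D B).step F S I P h) (potential F S I P B ε Δ V)
      ≤ ENNReal.ofReal (trialCost (otherRate (P.Accepts F S I t c)) out fail (f + 1)) := by
  classical
  have hnext : (pairExtractor L n k D B).next (view F S I P h)
      = (PMF.uniformOfFintype (Leaf D)).map fun j => ⟨s, c, j⟩ := by
    rw [modeAfter] at hm
    simp only [pairExtractor, hm]
  rw [expectation_step_of_inSession ho hs hnext fun _ => rfl,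
    ← one_add_expectation_trialCost hacc hout hfail]
  gcongr
  refine expectation_mono _ fun j => ?_
  split_ifs with hj
  · exact hsucc j hj.2 hj.1
  · exact hretry j (modeAfter_cons_of_rep_of_not hm hj)

theorem step_firstRep_le (hr : 1 ≤ r) (hB : B ≠ 0) (hΔ : 0 ≤ Δ)
    (hε : soundnessError (Fintype.card F) (Module.finrank F K) (Module.finrank K L) D ≤ ε)
    (hV : 0 ≤ V) (ho : Extractor.output F S I P h = none)
    (hm : modeAfter F S I P B h = .rep false s c i f) (hs : InSession h s t)
    (hobs : ObservedAccept F S I P h t c i) :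
    1 + expectation ((pairExtractor L n k D B).step F S I P h) (potential F S I P B ε Δ V)
      ≤ ENNReal.ofReal (trialCost (otherRate (P.Accepts F S I t c))
        (pairPotential (P.Accepts F S I t) B ε Δ V) V (f + 1)) := by
  have hobs_cons (j : Leaf D) : ObservedAccept F S I P ((⟨s, c, j⟩, t) :: h) t c i :=
    hobs.mono (List.subset_cons_self _ _)
  have hε₁ : 1 / Fintype.card (Leaf D) ≤ ε := (one_div_card_le_soundnessError ..).trans hε
  refine step_rep_le ho hm hs hobs.1 (pairPotential_nonneg hΔ hε₁ hV B) hV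
    (fun j hj hacc => potential_le_of_output_eq_none_imp fun ho' => ?_)
    fun j hmode => potential_le (.of_retry_false hmode (inSession_cons ..) (hobs_cons j))
  obtain ⟨G, hdens, hconfines⟩ :=
    exists_confines hr ho' hj (t := t) (c₁ := c) (c₂ := c) ⟨hacc, List.mem_cons_self⟩ (hobs_cons j)
  exact .pair (modeAfter_cons_of_rep_of_accepts hm hj hacc) (inSession_cons ..)
    ⟨(pairProb_pos hB hacc hobs.1 hj).ne', (cheatingRate_le_soundnessError hdens).trans hε,
      hconfines⟩

open Classical in
theorem step_secondRep_le (hΔ : 0 ≤ Δ) (hε : 1 / Fintype.card (Leaf D) ≤ ε) (hV : 0 ≤ V)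
    (ho : Extractor.output F S I P h = none)
    (hm : modeAfter F S I P B h = .rep true s c i f) (hs : InSession h s t)
    (hobs : ObservedAccept F S I P h t c i) (hG : PairFound F S I P B ε h t G) :
    1 + expectation ((pairExtractor L n k D B).step F S I P h) (potential F S I P B ε Δ V)
      ≤ ENNReal.ofReal (trialCost (otherRate (P.Accepts F S I t c)) (if c ∈ G then V else 0)
        (pairPotential (P.Accepts F S I t) B ε Δ V) (f + 1)) := by
  have hobs_cons (j : Leaf D) : ObservedAccept F S I P ((⟨s, c, j⟩, t) :: h) t c i :=
    hobs.mono (List.subset_cons_self _ _)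
  refine step_rep_le ho hm hs hobs.1 (by split_ifs; exacts [hV, le_rfl])
    (pairPotential_nonneg hΔ hε hV B)
    (fun j hj hacc => potential_le_of_output_eq_none_imp fun ho' => ?_) fun j hmode =>
    potential_le (.of_retry_true hmode (inSession_cons ..) (hobs_cons j) (hG.cons _))
  have hc : c ∈ G := hG.confines _ (List.subset_cons_self _ _) ho' c j i hj
    ⟨hacc, List.mem_cons_self⟩ (hobs_cons j)
  rw [if_pos hc]
  exact .start (modeAfter_cons_of_rep_of_accepts hm hj hacc)

theorem one_add_expectation_potential_le (hr : 1 ≤ r) (hB : B ≠ 0) (hΔ : 0 ≤ Δ)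
    (hε : soundnessError (Fintype.card F) (Module.finrank F K) (Module.finrank K L) D ≤ ε)
    (hV : 0 ≤ V)
    (hstart : 2 * (1 + B * P.acceptProb S I (Fintype.card F))
      ≤ V * (tangentSlope (B * Δ) * (P.acceptProb S I (Fintype.card F) - ε)
        - tangentOffset (B * Δ) Δ))
    (ho : Extractor.output F S I P h = none) :
    1 + expectation ((pairExtractor L n k D B).step F S I P h) (potential F S I P B ε Δ V)
      ≤ potential F S I P B ε Δ V h := by
  have hε₁ : 1 / Fintype.card (Leaf D) ≤ ε := (one_div_card_le_soundnessError ..).trans hε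
  refine le_iInf₂ fun v hv => ?_
  cases hv with
  | halted ho' => simp [ho] at ho'
  | start hm => exact step_start_le hΔ hε₁ hV hstart ho hm
  | pair hm hs hG => exact step_pair_le hΔ hε₁ hV ho hm hs hG
  | firstRep hm hs hobs => exact step_firstRep_le hr hB hΔ hε hV ho hm hs hobs
  | secondRep hm hs hobs hG => exact step_secondRep_le hΔ hε₁ hV ho hm hs hobs hG

end Steps

end RankSD

end

open RankSD in
theorem mainTheorem3_general {F K L : Type*} [Field F] [Fintype F] [Field K] [Finite K] [Field L]
    [Fintype L] [Algebra F K] [Algebra K L] (q m η n k r D : ℕ)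
    (hq : Fintype.card F = q) (hm : Module.finrank F K = m) (hη : Module.finrank K L = η)
    (hr : 1 ≤ r) (εt : ℝ) (hε : soundnessError q m η D < εt) :
    ∃ E : Extractor L n k D,
      ∀ {Seed Salt Rnd Cmt Dig Tape : Type*}
        (S : Primitives K L k r D Seed Salt Rnd Cmt Dig) (I : Instance K n k)
        (P : Prover K L n k r D Seed Salt Cmt Dig Tape),
        εt ≤ P.acceptProb S I q →
        Filter.Tendsto (fun t => E.successProb F S I P t) Filter.atTop (nhds 1) ∧
        E.expectedCalls F S I P ≤ ENNReal.ofReal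
          (4 / (εt - soundnessError q m η D) *
            (1 + 2 * εt * Real.log 2 / (εt - soundnessError q m η D))) := by
  subst hq hm hη
  set ε := soundnessError (Fintype.card F) (Module.finrank F K) (Module.finrank K L) D
  set Δ := εt - ε
  have hΔ : 0 < Δ := sub_pos.2 hε
  have hε₀ : 0 ≤ ε := le_trans (by positivity) (one_div_card_le_soundnessError ..)
  have hB : 0 < repetitions Δ := repetitions_pos hΔ
  set V := startPotential (repetitions Δ) Δ εt
  have hV : 0 ≤ V := startPotential_nonneg hΔ.le (by linarith) _
  refine ⟨pairExtractor L n k D (repetitions Δ), fun S I P hacc => ?_⟩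
  have hstep := two_mul_one_add_mul_le hB hΔ hε₀ (add_sub_cancel ε εt).symm hacc
  have hcalls : (pairExtractor L n k D (repetitions Δ)).expectedCalls F S I P ≤ ENNReal.ofReal V :=
    (Extractor.expectedCalls_le_of_potential _ fun _ =>
      one_add_expectation_potential_le hr hB.ne' hΔ.le le_rfl hV hstep).trans
      (potential_le (.start rfl))
  exact ⟨Extractor.tendsto_successProb_of_expectedCalls_ne_top
      (ne_top_of_le_ne_top ENNReal.ofReal_ne_top hcalls),
    hcalls.trans <| ENNReal.ofReal_le_ofReal <|
      startPotential_le hΔ (by linarith) (hacc.trans (acceptProb_le_one S I P))⟩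

open RankSD in
theorem mainTheorem3 {F K L : Type*} [Field F] [Fintype F] [Field K] [Finite K] [Field L]
    [Fintype L] [Algebra F K] [Algebra K L] (q m η n k r D : ℕ)
    (hq : Fintype.card F = q) (hm : Module.finrank F K = m) (hη : Module.finrank K L = η)
    (hkn : k ≤ n) (hr : 1 ≤ r) (εt : ℝ) (hε : soundnessError q m η D < εt) :
    ∃ E : Extractor L n k D,
      ∀ {Seed Salt Rnd Cmt Dig Tape : Type*}
        (S : Primitives K L k r D Seed Salt Rnd Cmt Dig) (I : Instance K n k)
        (P : Prover K L n k r D Seed Salt Cmt Dig Tape),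
        P.acceptProb S I q = εt →
        Filter.Tendsto (fun t => E.successProb F S I P t) Filter.atTop (nhds 1) ∧
        E.expectedCalls F S I P ≤ ENNReal.ofReal
          (4 / (εt - soundnessError q m η D) *
            (1 + 2 * εt * Real.log 2 / (εt - soundnessError q m η D))) :=
  (mainTheorem3_general q m η n k r D hq hm hη hr εt hε).imp
    fun _ hE _ _ _ _ _ _ S I P hacc => hE S I P hacc.ge
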